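/- Let $\mathbb S=\{z\in\mathbb C:|z|=1\}$, let $V:\mathbb S\to\mathbb R$ be a non-constant $C^3$ function (i.e. $x\mapsto V(e^{ix})$ is $C^3$) with $\int_{\mathbb S}V(w)\,dw=0$, where $dw$ is arc length, and put $W(x)=V(e^{ix})$, $x\in\mathbb R$. Let $\alpha\in(0,2)$. For $(y,s)\in\mathbb R^2$ let $g(y,s,x)=((W(y)-W(y+x))s)_+\mathbf 1_{(-\pi,\pi)}(x)$ and $\|g(y,s,\cdot)\|_1=\int_{-\pi}^{\pi}g(y,s,x)\,dx$. Let $F_{y,s}$ be the distribution function of the law with density $g(y,s,\cdot)/\|g(y,s,\cdot)\|_1$, or of the unit mass at $0$ if $\|g(y,s,\cdot)\|_1=0$, and $F_{y,s}^{-1}(v)=\inf\{x:F_{y,s}(x)\ge v\}$. On a probability space let $X$ be a càdlàg symmetric $\alpha$-stable Lévy process on $\mathbb R$ with $X_0=0$ and $\mathbb E e^{i\xi X_t}=e^{-t|\xi|^\alpha}$, $N$ a Poisson process of intensity $1$ with jump times $\sigma_1<\sigma_2<\dots$ (and $\sigma_0=0$), and $(U_n)_{n\ge1}$ i.i.d.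 uniform on $(0,1)$, with $X$, $N$, $(U_n)$ independent; put $\eta_n(y,s)=F_{y,s}^{-1}(U_n)$. For a starting point $(y,s)$ define $(Y,S)$ recursively: $\tau_0=0$, $S^0(0-)=s$, and, if $\tau_j<\infty$, for $t\ge\tau_j$ $$Y^{j+1}_t=y+X_t+\sum_{n=1}^{j}\eta_n\big(Y^n(\tau_n-),S^n(\tau_n-)\big),\qquad S^{j+1}_t=S^j(\tau_j-)+\int_{\tau_j}^tW(Y^{j+1}_r)\,dr,$$ $$\tau_{j+1}=\inf\Big\{t\ge\tau_j:\ \sigma_j+\int_{\tau_j}^t\|g(Y^{j+1}_r,S^{j+1}_r,\cdot)\|_1\,dr=\sigma_{j+1}\Big\}\quad(\inf\emptyset=\infty),$$ and $(Y_t,S_t)=(Y^{j+1}_t,S^{j+1}_t)$ for $\tau_j\le t<\tau_{j+1}$, $j\ge0$. Let $(\hat Y_t,\hat S_t)=(y+X_t,\ s+\int_0^tW(\hat Y_r)\,dr)$ be the jump-free process. Put $T_tf(y,s)=\mathbb E^{(y,s)}f(Y_t,S_t)$ and $\hat T_tf(y,s)=\mathbb E^{(y,s)}f(\hat Y_t,\hat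 S_t)$. Let $C_*(\mathbb R^2)$ be the set of bounded, uniformly continuous $f:\mathbb R^2\to\mathbb R$ with $\operatorname{supp} f\subset\mathbb R\times[-M,M]$ for some $M>0$, and let $$Rf(y,s)=\int_{y-\pi}^{y+\pi}\big(f(x,s)-f(y,s)\big)\big((W(y)-W(x))s\big)_+\,dx .$$ (1) For every $f\in C_*(\mathbb R^2)$, the limit $\lim_{t\to0^+}(T_tf-f)/t$ exists in $\|\cdot\|_\infty$ if and only if $\lim_{t\to0^+}(\hat T_tf-f)/t$ exists in $\|\cdot\|_\infty$; and if one, hence both, exist, then $$\lim_{t\to0^+}\frac{T_tf-f}{t}=\lim_{t\to0^+}\frac{\hat T_tf-f}{t}+Rf .$$ (2) $R$ is bounded on functions supported in a fixed strip: for every $M$ there is a constant $C$ with $\|Rf\|_\infty\le C\|f\|_\infty$ for all $f\in C_*(\mathbb R^2)$ with $\operatorname{supp}f\subset\mathbb R\times[-M,M]$. (3) Let $\mathcal G$ and $\hat{\mathcal G}$ be the generators, with domains $\mathcal D(\mathcal G)$ and $\mathcal D(\hat{\mathcal G})$, of the transition semigroups of $(e^{iY_t},S_t)$ and $(e^{i\hat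 Y_t},\hat S_t)$ on $C_0(\mathbb S\times\mathbb R)$ (where the process started at $(z,s)$ is obtained by starting the process on $\mathbb R^2$ at $(y,s)$ with $e^{iy}=z$). Then $$\mathcal D(\mathcal G)\cap C_c(\mathbb S\times\mathbb R)=\mathcal D(\hat{\mathcal G})\cap C_c(\mathbb S\times\mathbb R),$$ and for $f$ in this set $\mathcal Gf=\hat{\mathcal G}f+R^{\mathbb S}f$, where $$R^{\mathbb S}f(z,s)=\int_{\mathbb S}\big(f(w,s)-f(z,s)\big)\big((V(z)-V(w))s\big)_+\,dw .$$ -/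

import Mathlib

open MeasureTheory ProbabilityTheory Filter Topology Set
open scoped NNReal ENNReal ZeroAtInfty

noncomputable section

namespace MemoryJump

/-! ### Driving processes -/

/-- Right-continuous paths with left limits. -/
def IsCadlag {E : Type*} [TopologicalSpace E] (x : ℝ≥0 → E) : Prop :=
  ∀ t, ContinuousWithinAt x (Ici t) t ∧ ∃ l, Tendsto x (𝓝[<] t) (𝓝 l)

/-- `X` is a symmetric `α`-stable Lévy process on `ℝ` started at `0`, normalized so that its
generator is `-(-Δ)^{α/2}`, i.e. `𝔼 exp (i ξ (X_t - X_s)) = exp (-(t - s) |ξ|^α)` for `s ≤ t`. -/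
structure IsSymmetricStableProcess {Ω : Type*} [MeasurableSpace Ω] (α : ℝ)
    (X : ℝ≥0 → Ω → ℝ) (P : Measure Ω) : Prop where
  measurable : ∀ t, Measurable (X t)
  start : ∀ᵐ ω ∂P, X 0 ω = 0
  indepIncrements : HasIndepIncrements X P
  charFun_increment : ∀ s t : ℝ≥0, s ≤ t → ∀ ξ : ℝ,
    charFun (P.map (fun ω => X t ω - X s ω)) ξ =
      Complex.exp ((-(((t : ℝ) - (s : ℝ)) * |ξ| ^ α) : ℝ) : ℂ)
  cadlag : ∀ᵐ ω ∂P, IsCadlag (fun t => X t ω)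

/-- `N` is a Poisson process with intensity `1`. -/
structure IsPoissonProcess {Ω : Type*} [MeasurableSpace Ω]
    (N : ℝ≥0 → Ω → ℕ) (P : Measure Ω) : Prop where
  measurable : ∀ t, Measurable (N t)
  start : ∀ᵐ ω ∂P, N 0 ω = 0
  indepIncrements : HasIndepIncrements N P
  law_increment : ∀ s t : ℝ≥0, s ≤ t →
    P.map (fun ω => N t ω - N s ω) = poissonMeasure (t - s)
  monotone : ∀ᵐ ω ∂P, Monotone (fun t => N t ω)
  cadlag : ∀ᵐ ω ∂P, IsCadlag (fun t => N t ω)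

/-- `U` is a sequence of independent random variables, uniformly distributed on `(0,1)`. -/
structure IsUniformSequence {Ω : Type*} [MeasurableSpace Ω]
    (U : ℕ → Ω → ℝ) (P : Measure Ω) : Prop where
  measurable : ∀ n, Measurable (U n)
  indep : iIndepFun U P
  law : ∀ n, P.map (U n) = (volume : Measure ℝ).restrict (Ioo 0 1)

/-- The process families `X`, `N`, `U` are (mutually) independent: `X` is independent of `N`, and
the pair `(X, N)` is independent of `U`. -/
def IndependentDrivers {Ω : Type*} [MeasurableSpace Ω] (X : ℝ≥0 → Ω → ℝ) (N : ℝ≥0 → Ω → ℕ)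
    (U : ℕ → Ω → ℝ) (P : Measure Ω) : Prop :=
  IndepFun (fun ω t => X t ω) (fun ω t => N t ω) P ∧
  IndepFun (fun ω => ((fun t => X t ω), (fun t => N t ω))) (fun ω n => U n ω) P

/-- The time of the `k`-th jump of a unit-jump counting path `n` started at `0`. -/
def jumpTime (n : ℝ≥0 → ℕ) (k : ℕ) : ℝ≥0 := sInf {t | k ≤ n t}

/-! ### The jump density -/

/-- `g(y,s,x) = ((W(y) - W(y+x)) s)₊ 1_{(-π,π)}(x)`. -/
def g (W : ℝ → ℝ) (y s x : ℝ) : ℝ :=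
  (Ioo (-Real.pi) Real.pi).indicator (fun x => max ((W y - W (y + x)) * s) 0) x

/-- `‖g(y,s,·)‖₁`. -/
def gNorm (W : ℝ → ℝ) (y s : ℝ) : ℝ := ∫ x in (-Real.pi)..Real.pi, g W y s x

open Classical in
/-- The distribution function `F_{y,s}` of the law with density `g(y,s,·)/‖g(y,s,·)‖₁`, or of the
unit mass at `0` if `‖g(y,s,·)‖₁ = 0`. -/
def jumpCDF (W : ℝ → ℝ) (y s x : ℝ) : ℝ :=
  if gNorm W y s = 0 then (if 0 ≤ x then 1 else 0)
  else ∫ z in Iic x, g W y s z / gNorm W y s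

/-- `F_{y,s}^{-1}(v)`. -/
def jumpQuantile (W : ℝ → ℝ) (y s v : ℝ) : ℝ := sInf {x | v ≤ jumpCDF W y s x}

/-! ### The pathwise construction of `(Y, S)`

Throughout, `x` is a path of `X`, `σ k` is the `k`-th jump time of the Poisson path (with
`σ 0 = 0`), `u` is a sequence of values of the uniform variables (`u j` is used for the jump
number `j + 1`), and `(y, s)` is the starting point. -/

/-- The data available after `j` jumps: the jump time `τ_j ∈ [0,∞]` (with `τ_0 = 0`), the sum of
the first `j` jumps, and the value of `S` at time `τ_j`. -/
structure Stage where
  time : ℝ≥0∞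
  jumps : ℝ
  memory : ℝ

/-- `Y^{j+1}_t = y + X_t + ∑_{n ≤ j} η_n`. -/
def stageY (x : ℝ≥0 → ℝ) (y : ℝ) (p : Stage) (t : ℝ≥0) : ℝ := y + x t + p.jumps

/-- `S^{j+1}_t = S(τ_j) + ∫_{τ_j}^t W(Y^{j+1}_r) dr`. -/
def stageS (W : ℝ → ℝ) (x : ℝ≥0 → ℝ) (y : ℝ) (p : Stage) (t : ℝ≥0) : ℝ :=
  p.memory + ∫ r in p.time.toReal..(t : ℝ), W (stageY x y p r.toNNReal)

/-- The clock `σ_j + ∫_{τ_j}^t ‖g(Y^{j+1}_r, S^{j+1}_r, ·)‖₁ dr`; here `a = σ_j`. -/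
def stageClock (W : ℝ → ℝ) (x : ℝ≥0 → ℝ) (y : ℝ) (p : Stage) (a : ℝ≥0) (t : ℝ≥0) : ℝ :=
  a + ∫ r in p.time.toReal..(t : ℝ),
    gNorm W (stageY x y p r.toNNReal) (stageS W x y p r.toNNReal)

/-- `τ_{j+1}`, the first time `t ≥ τ_j` at which the clock, started from `a = σ_j` at time `τ_j`,
equals `b = σ_{j+1}`; it is `∞` if there is none, in particular if `τ_j = ∞`. -/
def stageEnd (W : ℝ → ℝ) (x : ℝ≥0 → ℝ) (y : ℝ) (p : Stage) (a b : ℝ≥0) : ℝ≥0∞ :=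
  sInf {T | ∃ t : ℝ≥0, T = t ∧ p.time ≤ t ∧ stageClock W x y p a t = b}

/-- Passing from `j` to `j + 1` jumps: at time `τ_{j+1}` the jump
`η_{j+1}(Y^{j+1}(τ_{j+1}-), S^{j+1}(τ_{j+1}-))` is added. -/
def nextStage (W : ℝ → ℝ) (x : ℝ≥0 → ℝ) (y : ℝ) (p : Stage) (a b : ℝ≥0) (v : ℝ) : Stage :=
  let τ : ℝ≥0∞ := stageEnd W x y p a b
  let yLeft : ℝ := Function.leftLim (stageY x y p) τ.toNNReal
  let sLeft : ℝ := Function.leftLim (stageS W x y p) τ.toNNReal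
  { time := τ
    jumps := p.jumps + jumpQuantile W yLeft sLeft v
    memory := sLeft }

/-- The data after `j` jumps. -/
def stage (W : ℝ → ℝ) (x : ℝ≥0 → ℝ) (σ : ℕ → ℝ≥0) (u : ℕ → ℝ) (y s : ℝ) : ℕ → Stage
  | 0 => { time := 0, jumps := 0, memory := s }
  | j + 1 => nextStage W x y (stage W x σ u y s j) (σ j) (σ (j + 1)) (u j)

/-- The index `j` with `τ_j ≤ t < τ_{j+1}` (the number of jumps up to time `t`). -/
def stageIndex (W : ℝ → ℝ) (x : ℝ≥0 → ℝ) (σ : ℕ → ℝ≥0) (u : ℕ → ℝ) (y s : ℝ) (t : ℝ≥0) : ℕ :=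
  sInf {j | (stage W x σ u y s j).time ≤ t ∧ (t : ℝ≥0∞) < (stage W x σ u y s (j + 1)).time}

/-- The path `(Y_t, S_t)`, equal to `(Y^{j+1}_t, S^{j+1}_t)` for `τ_j ≤ t < τ_{j+1}`. -/
def pathYS (W : ℝ → ℝ) (x : ℝ≥0 → ℝ) (σ : ℕ → ℝ≥0) (u : ℕ → ℝ) (q : ℝ × ℝ) (t : ℝ≥0) : ℝ × ℝ :=
  let p : Stage := stage W x σ u q.1 q.2 (stageIndex W x σ u q.1 q.2 t)
  (stageY x q.1 p t, stageS W x q.1 p t)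

/-- The jump-free path `(Ŷ_t, Ŝ_t) = (y + X_t, s + ∫_0^t W(Ŷ_r) dr)`. -/
def pathHat (W : ℝ → ℝ) (x : ℝ≥0 → ℝ) (q : ℝ × ℝ) (t : ℝ≥0) : ℝ × ℝ :=
  (q.1 + x t, q.2 + ∫ r in (0 : ℝ)..(t : ℝ), W (q.1 + x r.toNNReal))

/-! ### Semigroups on `ℝ²` and on `𝕊 × ℝ` -/

section Semigroups

variable {Ω : Type*} [MeasurableSpace Ω]

/-- The process `(Y_t, S_t)` started at `q`. -/
def processYS (W : ℝ → ℝ) (X : ℝ≥0 → Ω → ℝ) (N : ℝ≥0 → Ω → ℕ) (U : ℕ → Ω → ℝ)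
    (q : ℝ × ℝ) (t : ℝ≥0) (ω : Ω) : ℝ × ℝ :=
  pathYS W (fun r => X r ω) (jumpTime (fun r => N r ω)) (fun n => U n ω) q t

/-- The process `(Ŷ_t, Ŝ_t)` started at `q`. -/
def processHat (W : ℝ → ℝ) (X : ℝ≥0 → Ω → ℝ) (q : ℝ × ℝ) (t : ℝ≥0) (ω : Ω) : ℝ × ℝ :=
  pathHat W (fun r => X r ω) q t

/-- `T_t f(y,s) = 𝔼^{(y,s)} f(Y_t, S_t)`. -/
def semigroupYS (P : Measure Ω) (W : ℝ → ℝ) (X : ℝ≥0 → Ω → ℝ) (N : ℝ≥0 → Ω → ℕ)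
    (U : ℕ → Ω → ℝ) (t : ℝ≥0) (f : ℝ × ℝ → ℝ) (q : ℝ × ℝ) : ℝ :=
  ∫ ω, f (processYS W X N U q t ω) ∂P

/-- `T̂_t f(y,s) = 𝔼^{(y,s)} f(Ŷ_t, Ŝ_t)`. -/
def semigroupHat (P : Measure Ω) (W : ℝ → ℝ) (X : ℝ≥0 → Ω → ℝ)
    (t : ℝ≥0) (f : ℝ × ℝ → ℝ) (q : ℝ × ℝ) : ℝ :=
  ∫ ω, f (processHat W X q t ω) ∂P

/-- The covering map `(y,s) ↦ (e^{iy}, s)`. -/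
def wrap (q : ℝ × ℝ) : Circle × ℝ := (Circle.exp q.1, q.2)

/-- The preimage `(Arg z, s)` of `(z,s)` under `wrap`. -/
def unwrap (p : Circle × ℝ) : ℝ × ℝ := (Complex.arg (p.1 : ℂ), p.2)

/-- `T_t^𝕊 f(z,s) = 𝔼^{(z,s)} f(Z_t, S_t)` with `Z_t = e^{iY_t}`; the process started at `(z,s)` is
obtained by starting `(Y,S)` at `(y,s)` with `e^{iy} = z`. As `W` is `2π`-periodic, all choices of
`y` give the same law; we take `y = Arg z`. -/
def semigroupZS (P : Measure Ω) (W : ℝ → ℝ) (X : ℝ≥0 → Ω → ℝ) (N : ℝ≥0 → Ω → ℕ)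
    (U : ℕ → Ω → ℝ) (t : ℝ≥0) (f : Circle × ℝ → ℝ) (p : Circle × ℝ) : ℝ :=
  ∫ ω, f (wrap (processYS W X N U (unwrap p) t ω)) ∂P

/-- `T̂_t^𝕊 f(z,s) = 𝔼^{(z,s)} f(Ẑ_t, Ŝ_t)` with `Ẑ_t = e^{iŶ_t}`. -/
def semigroupZHat (P : Measure Ω) (W : ℝ → ℝ) (X : ℝ≥0 → Ω → ℝ)
    (t : ℝ≥0) (f : Circle × ℝ → ℝ) (p : Circle × ℝ) : ℝ :=
  ∫ ω, f (wrap (processHat W X (unwrap p) t ω)) ∂P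

end Semigroups

/-! ### Function spaces, generators, jump operators -/

/-- `C_*(ℝ²)`: bounded uniformly continuous functions with support in `ℝ × [-M, M]` for some
`M > 0`. -/
structure IsCStar (f : ℝ × ℝ → ℝ) : Prop where
  bounded : ∃ B : ℝ, ∀ q, |f q| ≤ B
  uniformContinuous : UniformContinuous f
  support : ∃ M : ℝ, 0 < M ∧ Function.support f ⊆ {q | |q.2| ≤ M}

/-- `lim_{t → 0+} (T_t f - f)/t = L` in the supremum norm. -/
def IsGenLimit {E : Type*} (T : ℝ≥0 → (E → ℝ) → E → ℝ) (f L : E → ℝ) : Prop :=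
  TendstoUniformly (fun (t : ℝ≥0) q => (T t f q - f q) / (t : ℝ)) L (𝓝[>] 0)

theorem IsGenLimit.unique {E : Type*} {T : ℝ≥0 → (E → ℝ) → E → ℝ} {f L L' : E → ℝ}
    (h : IsGenLimit T f L) (h' : IsGenLimit T f L') : L = L' :=
  funext fun q => tendsto_nhds_unique (h.tendsto_at q) (h'.tendsto_at q)

/-- The domain of the generator of the semigroup `T` on `C₀(E)`. -/
def genDomain {E : Type*} [TopologicalSpace E] (T : ℝ≥0 → (E → ℝ) → E → ℝ) : Set C₀(E, ℝ) :=
  {f | ∃ L : C₀(E, ℝ), IsGenLimit T f L}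

/-- The generator of the semigroup `T` on `C₀(E)`. -/
def generator {E : Type*} [TopologicalSpace E] (T : ℝ≥0 → (E → ℝ) → E → ℝ) (f : C₀(E, ℝ))
    (hf : f ∈ genDomain T) : C₀(E, ℝ) := Classical.choose hf

theorem generator_spec {E : Type*} [TopologicalSpace E] {T : ℝ≥0 → (E → ℝ) → E → ℝ}
    {f : C₀(E, ℝ)} (hf : f ∈ genDomain T) : IsGenLimit T f (generator T f hf) :=
  Classical.choose_spec hf

/-- `C_c(E)` as a subset of `C₀(E)`. -/
def CcSet (E : Type*) [TopologicalSpace E] : Set C₀(E, ℝ) :=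
  {f | HasCompactSupport f}

/-- `Rf(y,s) = ∫_{y-π}^{y+π} (f(x,s) - f(y,s)) ((W(y) - W(x)) s)₊ dx`. -/
def jumpOp (W : ℝ → ℝ) (f : ℝ × ℝ → ℝ) (q : ℝ × ℝ) : ℝ :=
  ∫ x in (-Real.pi + q.1)..(Real.pi + q.1),
    (f (x, q.2) - f q) * max ((W q.1 - W x) * q.2) 0

/-- The integral over the unit circle with respect to arc length (total mass `2π`). -/
def arcIntegral (F : Circle → ℝ) : ℝ := ∫ θ in (-Real.pi)..Real.pi, F (Circle.exp θ)

/-- `R^𝕊 f(z,s) = ∫_𝕊 (f(w,s) - f(z,s)) ((V(z) - V(w)) s)₊ dw`. -/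
def jumpOpCircle (V : Circle → ℝ) (f : Circle × ℝ → ℝ) (p : Circle × ℝ) : ℝ :=
  arcIntegral (fun w => (f (w, p.2) - f p) * max ((V p.1 - V w) * p.2) 0)

/-- `W(x) = V(e^{ix})`. -/
def lift (V : Circle → ℝ) (x : ℝ) : ℝ := V (Circle.exp x)

end MemoryJump

end

/-!
Write `q = (y, s)`. The processes `(Y, S)` and `(Ŷ, Ŝ)` from `q` agree before the first jump.
Memory moves at bounded speed, so from a fixed strip and for small `t` the jump rate is
bounded by some `Λ`, and the clock makes `j` jumps by time `t` only if `σ_j ≤ Λ t`. Two jumps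
therefore have probability `O(t²)`. The event that `X` leaves `[-δ, δ]` before `t` is independent of
`σ₁ ≤ Λ t`, so together they have probability `o(1) · O(t)`. As long as `X` stays in `[-δ, δ]`, the
rate is within `ε` of `‖g(q, ·)‖₁`; hence the first jump occurs with probability
`t ‖g(q, ·)‖₁ + o(t)`, and its height, whose uniform variable is independent of `(X, N)`, has a law
close to the one with density `g(q, ·) / ‖g(q, ·)‖₁`. Thus
`E f(Y_t, S_t) - E f(Ŷ_t, Ŝ_t) = t Rf(q) + o(t)` uniformly in `q`: all estimates use only moduli of
continuity of `W` and `f`, and both sides vanish when `s` is far from the strip supporting `f`. On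
`𝕊 × ℝ` the same expansion holds for `f(e^{iy}, s)`.
-/

noncomputable section

namespace MemoryJump

/-! ### Càdlàg paths -/

section Cadlag

variable {Ω E : Type*} [MeasurableSpace Ω]

theorem tendsto_ceil_mul_div (r : ℝ≥0) :
    Tendsto (fun n : ℕ => (⌈r * (n + 1)⌉₊ : ℝ≥0) / (n + 1)) atTop (𝓝[≥] r) := by
  have lower (n : ℕ) : r ≤ (⌈r * (n + 1)⌉₊ : ℝ≥0) / (n + 1) := by
    rw [le_div_iff₀ (by positivity)]
    exact Nat.le_ceil _
  have upper (n : ℕ) : (⌈r * (n + 1)⌉₊ : ℝ≥0) / (n + 1) ≤ r + 1 / ((n : ℝ≥0) + 1) := by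
    rw [div_le_iff₀ (by positivity), add_mul, one_div_mul_cancel (by positivity)]
    exact (Nat.ceil_lt_add_one (by positivity)).le
  have upper_tendsto : Tendsto (fun n : ℕ => r + 1 / ((n : ℝ≥0) + 1)) atTop (𝓝 r) := by
    simpa using tendsto_const_nhds.add (tendsto_one_div_add_atTop_nhds_zero_nat (𝕜 := ℝ≥0))
  exact tendsto_nhdsWithin_iff.2 ⟨tendsto_of_tendsto_of_tendsto_of_le_of_le tendsto_const_nhds
    upper_tendsto lower upper, Eventually.of_forall lower⟩

theorem measurable_uncurry_of_rightContinuous [TopologicalSpace E]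
    [TopologicalSpace.PseudoMetrizableSpace E] [MeasurableSpace E] [BorelSpace E]
    {X : Ω → ℝ≥0 → E} (hX : ∀ t, Measurable fun ω => X ω t)
    (hc : ∀ ω t, ContinuousWithinAt (X ω) (Ici t) t) :
    Measurable fun p : Ω × ℝ≥0 => X p.1 p.2 := by
  refine measurable_of_tendsto_metrizable
    (f := fun (n : ℕ) (p : Ω × ℝ≥0) => X p.1 ((⌈p.2 * (n + 1)⌉₊ : ℝ≥0) / (n + 1)))
    (fun n => ?_) (tendsto_pi_nhds.2 fun p => (hc p.1 p.2).tendsto.comp (tendsto_ceil_mul_div p.2))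
  have measurable_on_grid : Measurable fun q : ℕ × Ω => X q.2 ((q.1 : ℝ≥0) / (n + 1)) :=
    measurable_from_prod_countable_right fun k => hX (k / (n + 1))
  exact measurable_on_grid.comp
    ((Nat.measurable_ceil.comp (measurable_snd.mul_const _)).prodMk measurable_fst)

theorem IsCadlag.measurable [TopologicalSpace E] [TopologicalSpace.PseudoMetrizableSpace E]
    [MeasurableSpace E] [BorelSpace E] {x : ℝ≥0 → E} (hx : IsCadlag x) : Measurable x :=
  (measurable_uncurry_of_rightContinuous (Ω := Unit) (X := fun _ => x)
    (fun _ => measurable_const) fun _ t => (hx t).1).comp (measurable_prodMk_left (x := ()))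

theorem tendsto_mul_div_add_one_leftLim [TopologicalSpace E] {x : ℝ≥0 → E} {t : ℝ≥0}
    (h : ∃ l, Tendsto x (𝓝[<] t) (𝓝 l)) :
    Tendsto (fun n : ℕ => x (t * (n / (n + 1)))) atTop (𝓝 (Function.leftLim x t)) := by
  rcases eq_or_ne t 0 with rfl | ht
  · rw [leftLim_eq_of_isBot (fun _ => zero_le)]
    simp only [zero_mul, tendsto_const_nhds]
  · refine (tendsto_leftLim_of_tendsto h).comp (tendsto_nhdsWithin_iff.2 ⟨?_, ?_⟩)
    · have : Tendsto (fun n : ℕ => (n : ℝ≥0) / (n + 1)) atTop (𝓝 1) := by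
        rw [← NNReal.tendsto_coe]
        simpa using tendsto_natCast_div_add_atTop (1 : ℝ)
      simpa using this.const_mul t
    · refine Eventually.of_forall fun n => mul_lt_of_lt_one_right (pos_iff_ne_zero.2 ht) ?_
      rw [div_lt_one (by positivity)]
      exact lt_add_one _

theorem abs_leftLim_sub_le {x : ℝ≥0 → ℝ} {t : ℝ≥0} (h : ∃ l, Tendsto x (𝓝[<] t) (𝓝 l))
    {a c : ℝ} (hb : ∀ r ≤ t, |x r - a| ≤ c) : |Function.leftLim x t - a| ≤ c := by
  refine le_of_tendsto ((tendsto_mul_div_add_one_leftLim h).sub_const a).abs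
    (Eventually.of_forall fun n => hb _ (mul_le_of_le_one_right zero_le ?_))
  rw [div_le_one (by positivity)]
  exact le_self_add

theorem measurable_leftLim [TopologicalSpace E] [TopologicalSpace.PseudoMetrizableSpace E]
    [MeasurableSpace E] [BorelSpace E] {Z : Ω → ℝ≥0 → E}
    (hZ : Measurable fun p : Ω × ℝ≥0 => Z p.1 p.2)
    (hl : ∀ ω t, ∃ l, Tendsto (Z ω) (𝓝[<] t) (𝓝 l)) {τ : Ω → ℝ≥0} (hτ : Measurable τ) :
    Measurable fun ω => Function.leftLim (Z ω) (τ ω) :=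
  measurable_of_tendsto_metrizable (f := fun (n : ℕ) ω => Z ω (τ ω * (n / (n + 1))))
    (fun _ => hZ.comp (measurable_id.prodMk (hτ.mul_const _)))
    (tendsto_pi_nhds.2 fun ω => tendsto_mul_div_add_one_leftLim (hl ω (τ ω)))

theorem stronglyMeasurable_intervalIntegral [NormedAddCommGroup E] [NormedSpace ℝ E]
    {μ : Measure ℝ} [SFinite μ] {f : Ω → ℝ → E}
    (hf : StronglyMeasurable fun p : Ω × ℝ => f p.1 p.2) {a b : Ω → ℝ} (ha : Measurable a)
    (hb : Measurable b) : StronglyMeasurable fun ω => ∫ r in a ω..b ω, f ω r ∂μ := by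
  have on_Ioc {a b : Ω → ℝ} (ha : Measurable a) (hb : Measurable b) :
      StronglyMeasurable fun ω => ∫ r in Ioc (a ω) (b ω), f ω r ∂μ := by
    have hs : MeasurableSet {p : Ω × ℝ | p.2 ∈ Ioc (a p.1) (b p.1)} :=
      (measurableSet_lt (ha.comp measurable_fst) measurable_snd).inter
        (measurableSet_le measurable_snd (hb.comp measurable_fst))
    simp only [← integral_indicator measurableSet_Ioc]
    exact (hf.indicator hs).integral_prod_right'
  exact (on_Ioc ha hb).sub (on_Ioc hb ha)

end Cadlag

/-! ### Quantiles -/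

section Quantile

variable {μ : Measure ℝ} {v : ℝ}

/-- The generalized inverse of the distribution function of `μ`; it is only meaningful for levels
`v` in `(0, 1)`, the infimum of an empty or unbounded set being `0`. -/
def quantile (μ : Measure ℝ) (v : ℝ) : ℝ := sInf {x | v ≤ cdf μ x}

theorem bddBelow_setOf_le_cdf (hv : 0 < v) : BddBelow {x | v ≤ cdf μ x} := by
  obtain ⟨a, ha⟩ := ((tendsto_cdf_atBot μ).eventually_lt_const hv).exists
  exact ⟨a, fun x hx => le_of_not_gt fun hlt =>
    (hx.trans (monotone_cdf μ hlt.le)).not_gt ha⟩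

theorem nonempty_setOf_le_cdf (hv : v < 1) : {x | v ≤ cdf μ x}.Nonempty :=
  let ⟨b, hb⟩ := ((tendsto_cdf_atTop μ).eventually_const_lt hv).exists
  ⟨b, hb.le⟩

theorem quantile_le_iff (hv : 0 < v) (hne : {x | v ≤ cdf μ x}.Nonempty) {c : ℝ} :
    quantile μ v ≤ c ↔ v ≤ cdf μ c := by
  refine ⟨fun h => ?_, fun h => csInf_le (bddBelow_setOf_le_cdf hv) h⟩
  have right (x : ℝ) (hx : c < x) : v ≤ cdf μ x := by
    obtain ⟨z, hz, hzx⟩ := exists_lt_of_csInf_lt hne (h.trans_lt hx)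
    exact le_trans hz (monotone_cdf μ hzx.le)
  exact ge_of_tendsto (((cdf μ).right_continuous c).mono Ioi_subset_Ici_self)
    (eventually_nhdsWithin_of_forall right)

theorem monotoneOn_quantile (μ : Measure ℝ) : MonotoneOn (quantile μ) (Ioo 0 1) :=
  fun _ hv _ hw hvw => csInf_le_csInf (bddBelow_setOf_le_cdf hv.1) (nonempty_setOf_le_cdf hw.2)
    fun _ hx => hvw.trans hx

theorem aemeasurable_quantile (μ : Measure ℝ) :
    AEMeasurable (quantile μ) (volume.restrict (Ioo 0 1)) :=
  aemeasurable_restrict_of_monotoneOn measurableSet_Ioo (monotoneOn_quantile μ)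

theorem map_quantile (μ : Measure ℝ) [IsProbabilityMeasure μ] :
    (volume.restrict (Ioo (0 : ℝ) 1)).map (quantile μ) = μ := by
  have : IsFiniteMeasure (volume.restrict (Ioo (0 : ℝ) 1)) := ⟨by simp⟩
  refine Measure.ext_of_Iic _ _ fun c => ?_
  have preimage : quantile μ ⁻¹' Iic c =ᵐ[volume.restrict (Ioo 0 1)] Iic (cdf μ c) := by
    filter_upwards [ae_restrict_mem measurableSet_Ioo] with v hv
    exact propext (quantile_le_iff hv.1 (nonempty_setOf_le_cdf hv.2))
  rw [Measure.map_apply_of_aemeasurable (aemeasurable_quantile μ) measurableSet_Iic,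
    measure_congr preimage, Measure.restrict_congr_set Ioo_ae_eq_Ioc,
    Measure.restrict_apply measurableSet_Iic, inter_comm, Ioc_inter_Iic,
    min_eq_right (cdf_le_one μ c), Real.volume_Ioc, sub_zero, ofReal_cdf]

end Quantile

/-! ### The jump density and the law of a jump -/

section Density

open scoped Real

variable {W : ℝ → ℝ}

theorem abs_integral_mul_le {f k : ℝ → ℝ} {H : ℝ} (hH : ∀ x, |f x| ≤ H) (hk : Integrable k) :
    |∫ x, f x * k x| ≤ H * ∫ x, |k x| := by
  rw [← integral_const_mul, ← Real.norm_eq_abs]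
  refine norm_integral_le_of_norm_le (hk.abs.const_mul H) (Eventually.of_forall fun x => ?_)
  rw [Real.norm_eq_abs, abs_mul]
  gcongr
  exact hH x

theorem g_nonneg (y s x : ℝ) : 0 ≤ g W y s x :=
  indicator_nonneg (fun _ _ => le_max_right _ _) x

theorem measurable_g (hW : Continuous W) :
    Measurable fun p : (ℝ × ℝ) × ℝ => g W p.1.1 p.1.2 p.2 := by
  have h : Measurable fun p : (ℝ × ℝ) × ℝ => max ((W p.1.1 - W (p.1.1 + p.2)) * p.1.2) 0 := by
    fun_prop
  exact h.indicator (measurable_snd (measurableSet_Ioo (a := -π) (b := π)))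

theorem integrable_g (hW : Continuous W) (y s : ℝ) : Integrable (g W y s) := by
  have h : Continuous fun x => max ((W y - W (y + x)) * s) 0 := by fun_prop
  exact (integrable_indicator_iff measurableSet_Ioo).2
    ((h.continuousOn.integrableOn_Icc (a := -π) (b := π)).mono_set Ioo_subset_Icc_self)

theorem integral_mul_g (f : ℝ → ℝ) (y s : ℝ) :
    ∫ x, f x * g W y s x = ∫ x in (-π)..π, f x * max ((W y - W (y + x)) * s) 0 := by
  rw [intervalIntegral.integral_of_le (by linarith [Real.pi_pos]), integral_Ioc_eq_integral_Ioo,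
    ← integral_indicator measurableSet_Ioo]
  simp only [g, indicator_mul_right]

theorem gNorm_eq_intervalIntegral (y s : ℝ) :
    gNorm W y s = ∫ x in (-π)..π, max ((W y - W (y + x)) * s) 0 := by
  have hπ : -π ≤ π := by linarith [Real.pi_pos]
  rw [gNorm, intervalIntegral.integral_of_le hπ, integral_Ioc_eq_integral_Ioo,
    intervalIntegral.integral_of_le hπ, integral_Ioc_eq_integral_Ioo]
  exact setIntegral_congr_fun measurableSet_Ioo fun x hx => indicator_of_mem hx _

theorem integral_g (y s : ℝ) : ∫ x, g W y s x = gNorm W y s := by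
  simpa only [one_mul, ← gNorm_eq_intervalIntegral] using integral_mul_g (W := W) (fun _ => 1) y s

theorem gNorm_nonneg (y s : ℝ) : 0 ≤ gNorm W y s := by
  rw [← integral_g]
  exact integral_nonneg (g_nonneg y s)

theorem continuous_gNorm (hW : Continuous W) : Continuous fun q : ℝ × ℝ => gNorm W q.1 q.2 := by
  simp only [gNorm_eq_intervalIntegral]
  refine intervalIntegral.continuous_parametric_intervalIntegral_of_continuous'
    (f := fun (q : ℝ × ℝ) x => max ((W q.1 - W (q.1 + x)) * q.2) 0) ?_ _ _
  simp only [Function.uncurry_def]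
  fun_prop

theorem abs_integral_mul_g_le (hW : Continuous W) {f : ℝ → ℝ} {H : ℝ} (hH : ∀ x, |f x| ≤ H)
    (y s : ℝ) : |∫ x, f x * g W y s x| ≤ H * gNorm W y s := by
  simpa only [abs_of_nonneg (g_nonneg _ _ _), integral_g] using
    abs_integral_mul_le hH (integrable_g hW y s)

theorem abs_integral_mul_g_sub_le (hW : Continuous W) {f : ℝ → ℝ} (hf : Continuous f) {H : ℝ}
    (hH : ∀ x, |f x| ≤ H) (y s y' s' : ℝ) :
    |(∫ x, f x * g W y' s' x) - ∫ x, f x * g W y s x| ≤ H * ∫ x, |g W y' s' x - g W y s x| := by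
  have integrable_mul (y s : ℝ) : Integrable fun x => f x * g W y s x :=
    (integrable_g hW y s).bdd_mul hf.aestronglyMeasurable (Eventually.of_forall hH)
  rw [← integral_sub (integrable_mul y' s') (integrable_mul y s)]
  simpa only [← mul_sub, Pi.sub_apply] using
    abs_integral_mul_le hH ((integrable_g hW y' s').sub (integrable_g hW y s))

theorem abs_gNorm_sub_le (hW : Continuous W) (y s y' s' : ℝ) :
    |gNorm W y' s' - gNorm W y s| ≤ ∫ x, |g W y' s' x - g W y s x| := by
  simpa only [one_mul, integral_g] using
    abs_integral_mul_g_sub_le hW (f := fun _ => 1) continuous_const (fun _ => abs_one.le) y s y' s'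

theorem integral_abs_g_sub_le {c : ℝ} {y s y' s' : ℝ}
    (hc : ∀ x, |(W y' - W (y' + x)) * s' - (W y - W (y + x)) * s| ≤ c) :
    ∫ x, |g W y' s' x - g W y s x| ≤ 2 * π * c := by
  have pointwise (x : ℝ) : |g W y' s' x - g W y s x| ≤ (Ioo (-π) π).indicator (fun _ => c) x := by
    by_cases hx : x ∈ Ioo (-π) π
    · simp only [g, indicator_of_mem hx]
      exact (abs_max_sub_max_le_abs _ _ _).trans (hc x)
    · simp only [g, indicator_of_notMem hx, sub_self, abs_zero, le_refl]
  have integrable_bound : Integrable ((Ioo (-π) π).indicator fun _ => c) :=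
    (integrable_indicator_iff measurableSet_Ioo).2 (integrableOn_const (by simp))
  calc ∫ x, |g W y' s' x - g W y s x|
      ≤ ∫ x, (Ioo (-π) π).indicator (fun _ => c) x :=
        integral_mono_of_nonneg (Eventually.of_forall fun _ => abs_nonneg _) integrable_bound
          (Eventually.of_forall pointwise)
    _ = 2 * π * c := by
        rw [integral_indicator measurableSet_Ioo, setIntegral_const, Real.volume_real_Ioo_of_le
          (by linarith [Real.pi_pos]), smul_eq_mul]
        ring

theorem abs_difference_mul_sub_le {K ρ : ℝ} (hK : ∀ x, |W x| ≤ K) {y y' : ℝ}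
    (hρ : ∀ x, |W (y' + x) - W (y + x)| ≤ ρ) (s s' x : ℝ) :
    |(W y' - W (y' + x)) * s' - (W y - W (y + x)) * s| ≤ 2 * K * |s' - s| + 2 * ρ * |s| := by
  have difference_le : |W y' - W (y' + x)| ≤ 2 * K := by
    linarith [abs_sub (W y') (W (y' + x)), hK y', hK (y' + x)]
  have change_le : |(W y' - W y) - (W (y' + x) - W (y + x))| ≤ 2 * ρ := by
    have base_le : |W y' - W y| ≤ ρ := by simpa only [add_zero] using hρ 0
    linarith [abs_sub (W y' - W y) (W (y' + x) - W (y + x)), hρ x]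
  calc |(W y' - W (y' + x)) * s' - (W y - W (y + x)) * s|
      = |(W y' - W (y' + x)) * (s' - s) + ((W y' - W y) - (W (y' + x) - W (y + x))) * s| := by
        ring_nf
    _ ≤ |W y' - W (y' + x)| * |s' - s| + |(W y' - W y) - (W (y' + x) - W (y + x))| * |s| := by
        rw [← abs_mul, ← abs_mul]
        exact abs_add_le _ _
    _ ≤ 2 * K * |s' - s| + 2 * ρ * |s| := by gcongr

theorem gNorm_le (hW : Continuous W) {K : ℝ} (hK : ∀ x, |W x| ≤ K) (y s : ℝ) :
    gNorm W y s ≤ 4 * π * K * |s| := by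
  have h := (abs_gNorm_sub_le hW y 0 y s).trans
    (integral_abs_g_sub_le (abs_difference_mul_sub_le hK (ρ := 0) (by simp) 0 s))
  have gNorm_zero : gNorm W y 0 = 0 := by simp [gNorm_eq_intervalIntegral]
  rw [gNorm_zero, sub_zero, abs_of_nonneg (gNorm_nonneg y s)] at h
  exact h.trans_eq (by rw [sub_zero]; ring)

theorem measurable_jumpCDF (hW : Continuous W) (c : ℝ) :
    Measurable fun q : ℝ × ℝ => jumpCDF W q.1 q.2 c := by
  refine Measurable.ite ((continuous_gNorm hW).measurable (measurableSet_singleton 0))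
    measurable_const ?_
  have density : Measurable fun p : (ℝ × ℝ) × ℝ => g W p.1.1 p.1.2 p.2 / gNorm W p.1.1 p.1.2 :=
    (measurable_g hW).div ((continuous_gNorm hW).measurable.comp measurable_fst)
  exact density.stronglyMeasurable.integral_prod_right'.measurable

open Classical in
/-- The law of a jump from `(y, s)`, whose distribution function is `F_{y,s}`. -/
def jumpLaw (W : ℝ → ℝ) (y s : ℝ) : Measure ℝ :=
  if gNorm W y s = 0 then Measure.dirac 0
  else volume.withDensity fun x => ENNReal.ofReal (g W y s x / gNorm W y s)

theorem density_nonneg (y s x : ℝ) : 0 ≤ g W y s x / gNorm W y s :=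
  div_nonneg (g_nonneg y s x) (gNorm_nonneg y s)

theorem isProbabilityMeasure_jumpLaw (hW : Continuous W) (y s : ℝ) :
    IsProbabilityMeasure (jumpLaw W y s) := by
  unfold jumpLaw
  split_ifs with h
  · infer_instance
  · refine ⟨?_⟩
    rw [withDensity_apply _ MeasurableSet.univ, Measure.restrict_univ,
      ← ofReal_integral_eq_lintegral_ofReal ((integrable_g hW y s).div_const _)
        (Eventually.of_forall (density_nonneg y s)),
      integral_div, integral_g, div_self h, ENNReal.ofReal_one]

theorem cdf_jumpLaw (hW : Continuous W) (y s x : ℝ) : cdf (jumpLaw W y s) x = jumpCDF W y s x := by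
  have := isProbabilityMeasure_jumpLaw hW y s
  rw [cdf_eq_real]
  unfold jumpCDF jumpLaw
  split_ifs with h h0
  · simp [Measure.real, h0]
  · simp [Measure.real, h0]
  · rw [Measure.real, withDensity_apply _ measurableSet_Iic,
      ← ofReal_integral_eq_lintegral_ofReal ((integrable_g hW y s).div_const _).integrableOn
        (Eventually.of_forall (density_nonneg y s)),
      ENNReal.toReal_ofReal (integral_nonneg (density_nonneg y s))]

theorem jumpCDF_pi (y s : ℝ) : jumpCDF W y s π = 1 := by
  unfold jumpCDF
  split_ifs with h h0
  · rfl
  · exact absurd Real.pi_pos.le h0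
  · rw [integral_div, setIntegral_eq_integral_of_forall_compl_eq_zero, integral_g, div_self h]
    exact fun x hx => indicator_of_notMem (fun hx' => hx hx'.2.le) _

theorem jumpQuantile_eq_quantile (hW : Continuous W) (y s v : ℝ) :
    jumpQuantile W y s v = quantile (jumpLaw W y s) v := by
  simp only [jumpQuantile, quantile, cdf_jumpLaw hW]

theorem jumpQuantile_le_iff (hW : Continuous W) {y s v : ℝ} (hv : v ∈ Ioc (0 : ℝ) 1) (c : ℝ) :
    jumpQuantile W y s v ≤ c ↔ v ≤ jumpCDF W y s c := by
  rw [jumpQuantile_eq_quantile hW, ← cdf_jumpLaw hW, quantile_le_iff hv.1 ⟨π, ?_⟩]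
  rw [mem_ofPred_eq, cdf_jumpLaw hW, jumpCDF_pi]
  exact hv.2

theorem jumpQuantile_eq_zero (hW : Continuous W) {y s v : ℝ} (hv : v ∉ Ioc (0 : ℝ) 1) :
    jumpQuantile W y s v = 0 := by
  rw [jumpQuantile_eq_quantile hW, quantile]
  rcases le_or_gt v 0 with h0 | h0
  · rw [eq_univ_of_forall fun x => mem_ofPred.2 (h0.trans (cdf_nonneg _ x)), Real.sInf_univ]
  · have h1 : 1 < v := lt_of_not_ge fun h => hv ⟨h0, h⟩
    have no_level : {x | v ≤ cdf (jumpLaw W y s) x} = ∅ :=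
      eq_empty_of_forall_notMem fun x hx => ((cdf_le_one _ x).trans_lt h1).not_ge hx
    rw [no_level, Real.sInf_empty]

theorem measurable_jumpQuantile (hW : Continuous W) :
    Measurable fun p : (ℝ × ℝ) × ℝ => jumpQuantile W p.1.1 p.1.2 p.2 := by
  refine measurable_of_Iic fun c => ?_
  have preimage : (fun p : (ℝ × ℝ) × ℝ => jumpQuantile W p.1.1 p.1.2 p.2) ⁻¹' Iic c =
      {p | p.2 ∈ Ioc 0 1}.ite {p | p.2 ≤ jumpCDF W p.1.1 p.1.2 c} {_p | 0 ≤ c} := by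
    ext p
    by_cases hp : p.2 ∈ Ioc (0 : ℝ) 1
    · simp [Set.ite, jumpQuantile_le_iff hW hp, hp.1, hp.2]
    · rw [mem_preimage, jumpQuantile_eq_zero hW hp]
      exact ⟨fun h => Or.inr ⟨h, hp⟩, fun h => h.elim (fun h => absurd h.2 hp) And.left⟩
  rw [preimage]
  exact (measurable_snd measurableSet_Ioc).ite
    (measurableSet_le measurable_snd ((measurable_jumpCDF hW c).comp measurable_fst))
    (MeasurableSet.const _)

theorem integral_jumpLaw_mul_gNorm (hW : Continuous W) (f : ℝ → ℝ) (y s : ℝ) :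
    (∫ x, f x ∂jumpLaw W y s) * gNorm W y s = ∫ x, f x * g W y s x := by
  by_cases hG : gNorm W y s = 0
  · have density_zero : g W y s =ᵐ[volume] 0 :=
      (integral_eq_zero_iff_of_nonneg (g_nonneg y s) (integrable_g hW y s)).1
        ((integral_g y s).trans hG)
    rw [hG, mul_zero, eq_comm]
    refine integral_eq_zero_of_ae ?_
    filter_upwards [density_zero] with x hx
    rw [hx, Pi.zero_apply, mul_zero]
  · have density_measurable : Measurable fun x => g W y s x / gNorm W y s :=
      ((measurable_g hW).comp (measurable_prodMk_left (x := (y, s)))).div_const _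
    rw [jumpLaw, if_neg hG, integral_withDensity_eq_integral_toReal_smul
      density_measurable.ennreal_ofReal (Eventually.of_forall fun x => ENNReal.ofReal_lt_top),
      ← integral_mul_const]
    congr with x
    rw [ENNReal.toReal_ofReal (density_nonneg y s x), smul_eq_mul]
    field_simp

theorem integral_jumpQuantile_mul_gNorm (hW : Continuous W) {f : ℝ → ℝ} (hf : Continuous f)
    (y s : ℝ) :
    (∫ v in Ioo (0 : ℝ) 1, f (jumpQuantile W y s v)) * gNorm W y s = ∫ x, f x * g W y s x := by
  have := isProbabilityMeasure_jumpLaw hW y s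
  rw [← integral_jumpLaw_mul_gNorm hW, ← map_quantile (jumpLaw W y s),
    integral_map (aemeasurable_quantile _) hf.aestronglyMeasurable]
  simp only [jumpQuantile_eq_quantile hW]

end Density

/-! ### Stages -/

section Stage

variable {W : ℝ → ℝ} {K : ℝ} {x : ℝ≥0 → ℝ} {y : ℝ} {p : Stage}

/-- The rate `‖g(Y^{j+1}_r, S^{j+1}_r, ·)‖₁` at which the clock of a stage runs. -/
def stageRate (W : ℝ → ℝ) (x : ℝ≥0 → ℝ) (y : ℝ) (p : Stage) (r : ℝ≥0) : ℝ :=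
  gNorm W (stageY x y p r) (stageS W x y p r)

theorem stageRate_nonneg (r : ℝ≥0) : 0 ≤ stageRate W x y p r :=
  gNorm_nonneg _ _

theorem IsCadlag.stageY (hx : IsCadlag x) (y : ℝ) (p : Stage) : IsCadlag (stageY x y p) := by
  intro t
  obtain ⟨hr, l, hl⟩ := hx t
  exact ⟨(continuousWithinAt_const.add hr).add continuousWithinAt_const, y + l + p.jumps,
    (hl.const_add y).add_const p.jumps⟩

theorem intervalIntegrable_stageY (hW : Continuous W) (hK : ∀ x, |W x| ≤ K) (hx : IsCadlag x)
    (a b : ℝ) : IntervalIntegrable (fun r => W (stageY x y p r.toNNReal)) volume a b := by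
  refine (intervalIntegrable_const (c := K)).mono_fun' ?_ (Eventually.of_forall fun r => hK _)
  exact (hW.measurable.comp ((hx.stageY y p).measurable.comp
    measurable_real_toNNReal)).aestronglyMeasurable

theorem continuous_stageS (hW : Continuous W) (hK : ∀ x, |W x| ≤ K) (hx : IsCadlag x) :
    Continuous (stageS W x y p) :=
  continuous_const.add ((intervalIntegral.continuous_primitive
    (intervalIntegrable_stageY hW hK hx) _).comp NNReal.continuous_coe)

theorem abs_stageS_sub_memory_le (hK : ∀ x, |W x| ≤ K) {t : ℝ≥0} (ht : p.time ≤ t) :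
    |stageS W x y p t - p.memory| ≤ K * (t - p.time.toReal) := by
  have hle : p.time.toReal ≤ t := ENNReal.toReal_le_coe_of_le_coe ht
  rw [stageS, add_sub_cancel_left, ← abs_of_nonneg (sub_nonneg.2 hle)]
  exact intervalIntegral.norm_integral_le_of_norm_le_const
    (f := fun r : ℝ => W (stageY x y p r.toNNReal)) fun r _ => hK _

theorem measurable_stageRate (hW : Continuous W) (hK : ∀ x, |W x| ≤ K) (hx : IsCadlag x) :
    Measurable (stageRate W x y p) :=
  (continuous_gNorm hW).measurable.comp
    ((hx.stageY y p).measurable.prodMk (continuous_stageS hW hK hx).measurable)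

theorem intervalIntegrable_stageRate (hW : Continuous W) (hK : ∀ x, |W x| ≤ K) (hx : IsCadlag x)
    (a b : ℝ) : IntervalIntegrable (fun r => stageRate W x y p r.toNNReal) volume a b := by
  have bound_continuous : Continuous fun r : ℝ =>
      4 * Real.pi * K * |stageS W x y p r.toNNReal| :=
    continuous_const.mul ((continuous_stageS hW hK hx).comp continuous_real_toNNReal).abs
  refine (bound_continuous.intervalIntegrable a b).mono_fun' ((measurable_stageRate hW hK hx).comp
    measurable_real_toNNReal).aestronglyMeasurable (Eventually.of_forall fun r => ?_)
  beta_reduce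
  rw [Real.norm_of_nonneg (stageRate_nonneg _)]
  exact gNorm_le hW hK _ _

theorem continuous_stageClock (hW : Continuous W) (hK : ∀ x, |W x| ≤ K) (hx : IsCadlag x)
    (a : ℝ≥0) : Continuous (stageClock W x y p a) :=
  continuous_const.add ((intervalIntegral.continuous_primitive
    (intervalIntegrable_stageRate hW hK hx) _).comp NNReal.continuous_coe)

theorem monotone_stageClock (hW : Continuous W) (hK : ∀ x, |W x| ≤ K) (hx : IsCadlag x)
    (a : ℝ≥0) : Monotone (stageClock W x y p a) := by
  intro t t' htt'
  have increment : stageClock W x y p a t' =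
      stageClock W x y p a t + ∫ r in (t : ℝ)..t', stageRate W x y p r.toNNReal := by
    rw [stageClock, stageClock, add_assoc]
    exact congrArg _ (intervalIntegral.integral_add_adjacent_intervals
      (intervalIntegrable_stageRate hW hK hx _ _) (intervalIntegrable_stageRate hW hK hx _ _)).symm
  rw [increment]
  exact le_add_of_nonneg_right
    (intervalIntegral.integral_nonneg htt' fun r _ => stageRate_nonneg _)

theorem stageClock_time (a : ℝ≥0) : stageClock W x y p a p.time.toNNReal = a := by
  simp [stageClock, ENNReal.toReal]

theorem stageClock_le {Λ : ℝ} {a t : ℝ≥0} (ht : p.time ≤ t)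
    (hΛ : ∀ r : ℝ≥0, p.time ≤ r → r ≤ t → stageRate W x y p r ≤ Λ) :
    stageClock W x y p a t ≤ a + Λ * (t - p.time.toReal) := by
  have hle : p.time.toReal ≤ t := ENNReal.toReal_le_coe_of_le_coe ht
  rw [stageClock, ← abs_of_nonneg (sub_nonneg.2 hle)]
  refine add_le_add_right ((Real.le_norm_self _).trans
    (intervalIntegral.norm_integral_le_of_norm_le_const fun r hr => ?_)) _
  rw [uIoc_of_le hle] at hr
  refine (Real.norm_of_nonneg (stageRate_nonneg _)).trans_le
    (hΛ r.toNNReal ?_ (Real.toNNReal_le_iff_le_coe.2 hr.2))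
  rw [← ENNReal.ofReal_toReal (ne_top_of_le_ne_top ENNReal.coe_ne_top ht)]
  exact ENNReal.ofReal_le_ofReal hr.1.le

theorem stageEnd_spec (hW : Continuous W) (hK : ∀ x, |W x| ≤ K) (hx : IsCadlag x) {a b : ℝ≥0}
    (h : stageEnd W x y p a b ≠ ∞) : p.time ≤ stageEnd W x y p a b ∧
      stageClock W x y p a (stageEnd W x y p a b).toNNReal = b := by
  set S : Set ℝ≥0 := {t | p.time ≤ t ∧ stageClock W x y p a t = b}
  have S_closed : IsClosed S := (isClosed_le continuous_const ENNReal.continuous_coe).inter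
    (isClosed_eq (continuous_stageClock hW hK hx a) continuous_const)
  have stageEnd_eq_sInf_image : stageEnd W x y p a b = sInf ((↑) '' S) := by
    refine congrArg sInf (Set.ext fun T => ⟨?_, ?_⟩)
    · rintro ⟨t, rfl, ht⟩
      exact ⟨t, ht, rfl⟩
    · rintro ⟨t, ht, rfl⟩
      exact ⟨t, rfl, ht⟩
  have S_nonempty : S.Nonempty := nonempty_iff_ne_empty.2 fun hS => h (by
    rw [stageEnd_eq_sInf_image, hS, image_empty, sInf_empty])
  have stageEnd_eq : stageEnd W x y p a b = (sInf S : ℝ≥0) := by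
    rw [stageEnd_eq_sInf_image, ENNReal.coe_sInf S_nonempty, sInf_image]
  rw [stageEnd_eq, ENNReal.toNNReal_coe]
  exact S_closed.csInf_mem S_nonempty (OrderBot.bddBelow S)

theorem stageEnd_le_iff (hW : Continuous W) (hK : ∀ x, |W x| ≤ K) (hx : IsCadlag x)
    {a b c : ℝ≥0} : stageEnd W x y p a b ≤ c ↔
      a ≤ b ∧ p.time ≤ c ∧ (b : ℝ) ≤ stageClock W x y p a c := by
  have mono := monotone_stageClock (y := y) (p := p) hW hK hx a
  constructor
  · intro h
    have hne := ne_top_of_le_ne_top ENNReal.coe_ne_top h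
    obtain ⟨hle, hclock⟩ := stageEnd_spec hW hK hx hne
    refine ⟨?_, hle.trans h, ?_⟩
    · rw [← NNReal.coe_le_coe, ← stageClock_time (W := W) (x := x) (y := y) (p := p) a, ← hclock]
      exact mono (ENNReal.toNNReal_mono hne hle)
    · rw [← hclock]
      exact mono (ENNReal.toNNReal_mono ENNReal.coe_ne_top h)
  · rintro ⟨hab, hpc, hbc⟩
    have hb : (b : ℝ) ∈ Icc (stageClock W x y p a p.time.toNNReal) (stageClock W x y p a c) :=
      ⟨by rw [stageClock_time]; exact_mod_cast hab, hbc⟩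
    obtain ⟨t, ⟨hpt, htc⟩, htb⟩ := intermediate_value_Icc
      (ENNReal.toNNReal_mono ENNReal.coe_ne_top hpc)
      (continuous_stageClock hW hK hx a).continuousOn hb
    have hpt' : p.time ≤ t := by
      rw [← ENNReal.coe_toNNReal (ne_top_of_le_ne_top ENNReal.coe_ne_top hpc)]
      exact ENNReal.coe_le_coe.2 hpt
    exact sInf_le_of_le ⟨t, rfl, hpt', htb⟩ (ENNReal.coe_le_coe.2 htc)

end Stage

/-! ### Paths with jumps -/

section Path

variable {W : ℝ → ℝ} {K : ℝ} {x : ℝ≥0 → ℝ} {σ : ℕ → ℝ≥0} {u : ℕ → ℝ} {y s : ℝ} {q : ℝ × ℝ}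
  {t : ℝ≥0}

theorem stage_time_le_succ (hW : Continuous W) (hK : ∀ x, |W x| ≤ K) (hx : IsCadlag x) {j : ℕ}
    (h : (stage W x σ u y s (j + 1)).time ≤ t) :
    (stage W x σ u y s j).time ≤ (stage W x σ u y s (j + 1)).time :=
  (stageEnd_spec hW hK hx (ne_top_of_le_ne_top ENNReal.coe_ne_top h)).1

theorem abs_stageS_sub_le (hW : Continuous W) (hK : ∀ x, |W x| ≤ K) (hx : IsCadlag x) (j : ℕ)
    (h : (stage W x σ u y s j).time ≤ t) :
    |stageS W x y (stage W x σ u y s j) t - s| ≤ K * t := by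
  induction j generalizing t with
  | zero => simpa [stage] using abs_stageS_sub_memory_le (y := y) (x := x) hK h
  | succ j ih =>
    set τ := (stage W x σ u y s (j + 1)).time.toNNReal
    have hτ : (stage W x σ u y s (j + 1)).time = τ :=
      (ENNReal.coe_toNNReal (ne_top_of_le_ne_top ENNReal.coe_ne_top h)).symm
    have memory_eq : (stage W x σ u y s (j + 1)).memory =
        stageS W x y (stage W x σ u y s j) τ :=
      (continuous_stageS hW hK hx).continuousWithinAt.leftLim_eq
    have before := ih ((stage_time_le_succ hW hK hx h).trans_eq hτ)
    have after := abs_stageS_sub_memory_le (x := x) (y := y) hK h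
    rw [← memory_eq] at before
    rw [hτ, ENNReal.coe_toReal] at after
    calc |stageS W x y (stage W x σ u y s (j + 1)) t - s|
        ≤ |stageS W x y (stage W x σ u y s (j + 1)) t - (stage W x σ u y s (j + 1)).memory|
          + |(stage W x σ u y s (j + 1)).memory - s| := abs_sub_le _ _ _
      _ ≤ K * (t - τ) + K * τ := add_le_add after before
      _ = K * t := by ring

theorem abs_pathYS_snd_sub_le (hW : Continuous W) (hK : ∀ x, |W x| ≤ K) (hx : IsCadlag x) :
    |(pathYS W x σ u q t).2 - q.2| ≤ K * t := by
  refine abs_stageS_sub_le hW hK hx _ ?_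
  rcases Set.eq_empty_or_nonempty {j | (stage W x σ u q.1 q.2 j).time ≤ t ∧
    (t : ℝ≥0∞) < (stage W x σ u q.1 q.2 (j + 1)).time} with h | h
  · rw [stageIndex, h, Nat.sInf_empty]
    exact zero_le
  · exact (Nat.sInf_mem h).1

theorem pathHat_eq_stage_zero :
    pathHat W x q t = (stageY x q.1 (stage W x σ u q.1 q.2 0) t,
      stageS W x q.1 (stage W x σ u q.1 q.2 0) t) := by
  simp [pathHat, stageY, stageS, stage]

theorem abs_pathHat_snd_sub_le (hK : ∀ x, |W x| ≤ K) : |(pathHat W x q t).2 - q.2| ≤ K * t := by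
  simpa [pathHat, stageY, stageS] using
    abs_stageS_sub_memory_le (x := x) (y := q.1) (p := ⟨0, 0, q.2⟩) hK (t := t) zero_le

theorem pathYS_eq_pathHat (h : (t : ℝ≥0∞) < (stage W x σ u q.1 q.2 1).time) :
    pathYS W x σ u q t = pathHat W x q t := by
  have index : stageIndex W x σ u q.1 q.2 t = 0 := Nat.sInf_eq_zero.2 (Or.inl ⟨zero_le, h⟩)
  rw [pathHat_eq_stage_zero (σ := σ) (u := u), pathYS, index]

theorem pathYS_fst_of_one_jump (h1 : (stage W x σ u q.1 q.2 1).time ≤ t)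
    (h2 : (t : ℝ≥0∞) < (stage W x σ u q.1 q.2 2).time) :
    (pathYS W x σ u q t).1 = q.1 + x t + (stage W x σ u q.1 q.2 1).jumps := by
  have index : stageIndex W x σ u q.1 q.2 t = 1 := by
    refine le_antisymm (Nat.sInf_le ⟨h1, h2⟩) (Nat.one_le_iff_ne_zero.2 fun h => ?_)
    have between : (t : ℝ≥0∞) < (stage W x σ u q.1 q.2 (0 + 1)).time :=
      h ▸ (Nat.sInf_mem (s := {j | (stage W x σ u q.1 q.2 j).time ≤ t ∧
        (t : ℝ≥0∞) < (stage W x σ u q.1 q.2 (j + 1)).time}) ⟨1, h1, h2⟩).2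
    exact between.not_ge h1
  simp only [pathYS, index, stageY]

theorem le_mul_of_stage_time_le (hW : Continuous W) (hK : ∀ x, |W x| ≤ K) (hx : IsCadlag x)
    (hσ : σ 0 = 0) {Λ : ℝ} (hΛ : ∀ y' s', |s' - s| ≤ K * t → gNorm W y' s' ≤ Λ) (j : ℕ)
    (h : (stage W x σ u y s j).time ≤ t) :
    (σ j : ℝ) ≤ Λ * (stage W x σ u y s j).time.toReal := by
  induction j with
  | zero => simp [hσ, stage]
  | succ j ih =>
    have hle := stage_time_le_succ hW hK hx h
    have hne := ne_top_of_le_ne_top ENNReal.coe_ne_top h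
    have hτ := ENNReal.coe_toNNReal hne
    have clock_le := stageClock_le (W := W) (x := x) (y := y) (a := σ j) (hle.trans_eq hτ.symm)
      fun r hr hrτ => hΛ _ _ ((abs_stageS_sub_le hW hK hx j hr).trans
        (mul_le_mul_of_nonneg_left (NNReal.coe_le_coe.2
          (hrτ.trans (ENNReal.toNNReal_mono ENNReal.coe_ne_top h))) ((abs_nonneg _).trans (hK 0))))
    have clock_eq : stageClock W x y (stage W x σ u y s j) (σ j)
        (stage W x σ u y s (j + 1)).time.toNNReal = σ (j + 1) := (stageEnd_spec hW hK hx hne).2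
    rw [clock_eq, ENNReal.coe_toNNReal_eq_toReal] at clock_le
    linarith [ih (hle.trans h)]

theorem abs_stageClock_sub_le (hW : Continuous W) (hK : ∀ x, |W x| ≤ K) (hx : IsCadlag x)
    {G ε : ℝ} (hG : ∀ r ≤ t, |gNorm W (pathHat W x q r).1 (pathHat W x q r).2 - G| ≤ ε) :
    |stageClock W x q.1 (stage W x σ u q.1 q.2 0) 0 t - G * t| ≤ ε * t := by
  have clock_sub : stageClock W x q.1 (stage W x σ u q.1 q.2 0) 0 t - G * t =
      ∫ r in (0 : ℝ)..t, (stageRate W x q.1 (stage W x σ u q.1 q.2 0) r.toNNReal - G) := by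
    rw [intervalIntegral.integral_sub (intervalIntegrable_stageRate hW hK hx _ _)
      intervalIntegrable_const]
    simp [stageClock, stageRate, stage, mul_comm]
  rw [clock_sub]
  have rate_close (r : ℝ) (hr : r ∈ uIoc 0 (t : ℝ)) :
      ‖stageRate W x q.1 (stage W x σ u q.1 q.2 0) r.toNNReal - G‖ ≤ ε := by
    rw [uIoc_of_le t.coe_nonneg] at hr
    simpa only [pathHat_eq_stage_zero (σ := σ) (u := u), stageRate, Real.norm_eq_abs] using
      hG _ (Real.toNNReal_le_iff_le_coe.2 hr.2)
  simpa only [sub_zero, abs_of_nonneg t.coe_nonneg, Real.norm_eq_abs] using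
    intervalIntegral.norm_integral_le_of_norm_le_const rate_close

theorem le_of_stage_one_time_le (hW : Continuous W) (hK : ∀ x, |W x| ≤ K) (hx : IsCadlag x)
    (hσ : σ 0 = 0) {G ε : ℝ}
    (hG : ∀ r ≤ t, |gNorm W (pathHat W x q r).1 (pathHat W x q r).2 - G| ≤ ε)
    (h : (stage W x σ u q.1 q.2 1).time ≤ t) : (σ 1 : ℝ) ≤ (G + ε) * t := by
  have clock := (abs_le.1 (abs_stageClock_sub_le (σ := σ) (u := u) hW hK hx hG)).2
  have reached := ((stageEnd_le_iff hW hK hx).1 h).2.2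
  rw [hσ] at reached
  linarith

theorem stage_one_time_le_of_le (hW : Continuous W) (hK : ∀ x, |W x| ≤ K) (hx : IsCadlag x)
    (hσ : σ 0 = 0) {G ε : ℝ}
    (hG : ∀ r ≤ t, |gNorm W (pathHat W x q r).1 (pathHat W x q r).2 - G| ≤ ε)
    (h : (σ 1 : ℝ) ≤ (G - ε) * t) : (stage W x σ u q.1 q.2 1).time ≤ t := by
  have clock := (abs_le.1 (abs_stageClock_sub_le (σ := σ) (u := u) hW hK hx hG)).1
  refine (stageEnd_le_iff hW hK hx).2 ⟨by simp only [hσ, zero_le], zero_le, ?_⟩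
  rw [hσ]
  linarith

end Path

/-! ### Measurability of the construction -/

theorem measurable_sInf_nat {Ω : Type*} [MeasurableSpace Ω] {A : ℕ → Set Ω}
    (hA : ∀ j, MeasurableSet (A j)) : Measurable fun ω => sInf {j | ω ∈ A j} := by
  refine measurable_of_Iic fun k => ?_
  have preimage : (fun ω => sInf {j | ω ∈ A j}) ⁻¹' Iic k = (⋃ j ≤ k, A j) ∪ ⋂ j, (A j)ᶜ := by
    ext ω
    simp only [mem_preimage, mem_Iic, mem_union, mem_iUnion, mem_iInter, mem_compl_iff, exists_prop]
    constructor
    · intro h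
      by_cases hne : ∃ j, ω ∈ A j
      · exact Or.inl ⟨_, h, Nat.sInf_mem (s := {j | ω ∈ A j}) hne⟩
      · exact Or.inr (not_exists.1 hne)
    · rintro (⟨j, hj, hω⟩ | h)
      · exact (Nat.sInf_le hω).trans hj
      · rw [eq_empty_of_forall_notMem (s := {j | ω ∈ A j}) h, Nat.sInf_empty]
        exact zero_le
  rw [preimage]
  exact (MeasurableSet.biUnion (to_countable _) fun j _ => hA j).union
    (MeasurableSet.iInter fun j => (hA j).compl)

/-- A random stage with measurable components; `Stage` itself carries no `σ`-algebra. -/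
structure MeasurableStage {Ω : Type*} [MeasurableSpace Ω] (p : Ω → Stage) : Prop where
  time : Measurable fun ω => (p ω).time
  jumps : Measurable fun ω => (p ω).jumps
  memory : Measurable fun ω => (p ω).memory

section Measurability

variable {Ω : Type*} {mΩ : MeasurableSpace Ω} {W : ℝ → ℝ} {K : ℝ} {X : Ω → ℝ≥0 → ℝ}
  {σ : Ω → ℕ → ℝ≥0} {U : Ω → ℕ → ℝ} {p : Ω → Stage}

theorem measurable_coe_path (hX : Measurable X) (hc : ∀ ω, IsCadlag (X ω)) :
    Measurable fun z : Ω × ℝ≥0 => X z.1 z.2 :=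
  measurable_uncurry_of_rightContinuous (fun t => (measurable_pi_apply t).comp hX)
    fun ω t => (hc ω t).1

theorem MeasurableStage.measurable_integral (hp : MeasurableStage p) {h : Ω → ℝ≥0 → ℝ}
    (hh : Measurable fun z : Ω × ℝ≥0 => h z.1 z.2) :
    Measurable fun z : Ω × ℝ≥0 => ∫ r in (p z.1).time.toReal..(z.2 : ℝ), h z.1 r.toNNReal := by
  have integrand : Measurable fun z : (Ω × ℝ≥0) × ℝ => h z.1.1 z.2.toNNReal :=
    hh.comp ((measurable_fst.comp measurable_fst).prodMk
      (measurable_real_toNNReal.comp measurable_snd))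
  exact (stronglyMeasurable_intervalIntegral (f := fun z : Ω × ℝ≥0 => fun r => h z.1 r.toNNReal)
    integrand.stronglyMeasurable (hp.time.comp measurable_fst).ennreal_toReal
    (measurable_coe_nnreal_real.comp measurable_snd)).measurable

theorem measurable_stageY (hX : Measurable X) (hc : ∀ ω, IsCadlag (X ω)) (hp : MeasurableStage p)
    (y : ℝ) : Measurable fun z : Ω × ℝ≥0 => stageY (X z.1) y (p z.1) z.2 :=
  ((measurable_coe_path hX hc).const_add y).add (hp.jumps.comp measurable_fst)

theorem measurable_stageS (hW : Continuous W) (hX : Measurable X) (hc : ∀ ω, IsCadlag (X ω))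
    (hp : MeasurableStage p) (y : ℝ) :
    Measurable fun z : Ω × ℝ≥0 => stageS W (X z.1) y (p z.1) z.2 :=
  (hp.memory.comp measurable_fst).add
    (hp.measurable_integral (h := fun ω r => W (stageY (X ω) y (p ω) r))
      (hW.measurable.comp (measurable_stageY hX hc hp y)))

theorem measurable_stageClock (hW : Continuous W) (hX : Measurable X) (hc : ∀ ω, IsCadlag (X ω))
    (hp : MeasurableStage p) (y : ℝ) {a : Ω → ℝ≥0} (ha : Measurable a) :
    Measurable fun z : Ω × ℝ≥0 => stageClock W (X z.1) y (p z.1) (a z.1) z.2 :=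
  (measurable_coe_nnreal_real.comp (ha.comp measurable_fst)).add
    (hp.measurable_integral (h := fun ω => stageRate W (X ω) y (p ω))
      ((continuous_gNorm hW).measurable.comp
        ((measurable_stageY hX hc hp y).prodMk (measurable_stageS hW hX hc hp y))))

theorem measurable_stageEnd (hW : Continuous W) (hK : ∀ x, |W x| ≤ K) (hX : Measurable X)
    (hc : ∀ ω, IsCadlag (X ω)) (hp : MeasurableStage p) (y : ℝ) {a b : Ω → ℝ≥0}
    (ha : Measurable a) (hb : Measurable b) :
    Measurable fun ω => stageEnd W (X ω) y (p ω) (a ω) (b ω) := by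
  refine measurable_of_Iic fun c => ?_
  induction c using ENNReal.recTopCoe with
  | top => simp only [Iic_top, preimage_univ, MeasurableSet.univ]
  | coe c =>
    have preimage : (fun ω => stageEnd W (X ω) y (p ω) (a ω) (b ω)) ⁻¹' Iic (c : ℝ≥0∞) =
        {ω | a ω ≤ b ω} ∩ ({ω | (p ω).time ≤ c} ∩
          {ω | (b ω : ℝ) ≤ stageClock W (X ω) y (p ω) (a ω) c}) :=
      Set.ext fun ω => stageEnd_le_iff hW hK (hc ω)
    rw [preimage]
    exact (measurableSet_le ha hb).inter ((measurableSet_le hp.time measurable_const).inter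
      (measurableSet_le (measurable_coe_nnreal_real.comp hb)
        ((measurable_stageClock hW hX hc hp y ha).comp (measurable_prodMk_right (y := c)))))

theorem measurable_leftLim_stageY (hX : Measurable X) (hc : ∀ ω, IsCadlag (X ω))
    (hp : MeasurableStage p) (y : ℝ) {τ : Ω → ℝ≥0} (hτ : Measurable τ) :
    Measurable fun ω => Function.leftLim (stageY (X ω) y (p ω)) (τ ω) :=
  measurable_leftLim (measurable_stageY hX hc hp y)
    (fun ω t => ((hc ω).stageY y (p ω) t).2) hτ

theorem measurable_leftLim_stageS (hW : Continuous W) (hK : ∀ x, |W x| ≤ K) (hX : Measurable X)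
    (hc : ∀ ω, IsCadlag (X ω)) (hp : MeasurableStage p) (y : ℝ) {τ : Ω → ℝ≥0}
    (hτ : Measurable τ) :
    Measurable fun ω => Function.leftLim (stageS W (X ω) y (p ω)) (τ ω) :=
  measurable_leftLim (measurable_stageS hW hX hc hp y)
    (fun ω _ => ⟨_, (continuous_stageS hW hK (hc ω)).continuousWithinAt.tendsto⟩) hτ

theorem measurableStage_const (p : Stage) : MeasurableStage fun _ : Ω => p :=
  ⟨measurable_const, measurable_const, measurable_const⟩

theorem measurableStage_stage (hW : Continuous W) (hK : ∀ x, |W x| ≤ K) (hX : Measurable X)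
    (hc : ∀ ω, IsCadlag (X ω)) (hσ : Measurable σ) (hU : Measurable U) (y s : ℝ) (j : ℕ) :
    MeasurableStage fun ω => stage W (X ω) (σ ω) (U ω) y s j := by
  induction j with
  | zero => exact measurableStage_const _
  | succ j ih =>
    have time := measurable_stageEnd hW hK hX hc ih y ((measurable_pi_apply j).comp hσ)
      ((measurable_pi_apply (j + 1)).comp hσ)
    have yLeft := measurable_leftLim_stageY hX hc ih y time.ennreal_toNNReal
    have sLeft := measurable_leftLim_stageS hW hK hX hc ih y time.ennreal_toNNReal
    exact ⟨time, ih.jumps.add ((measurable_jumpQuantile hW).comp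
      ((yLeft.prodMk sLeft).prodMk ((measurable_pi_apply j).comp hU))), sLeft⟩

theorem measurable_pathYS (hW : Continuous W) (hK : ∀ x, |W x| ≤ K) (hX : Measurable X)
    (hc : ∀ ω, IsCadlag (X ω)) (hσ : Measurable σ) (hU : Measurable U) (q : ℝ × ℝ) (t : ℝ≥0) :
    Measurable fun ω => pathYS W (X ω) (σ ω) (U ω) q t := by
  have stages := measurableStage_stage hW hK hX hc hσ hU q.1 q.2
  have index : Measurable fun ω => stageIndex W (X ω) (σ ω) (U ω) q.1 q.2 t :=
    measurable_sInf_nat fun j => (measurableSet_le (stages j).time measurable_const).inter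
      (measurableSet_lt measurable_const (stages (j + 1)).time)
  have stage_value : Measurable fun z : ℕ × Ω =>
      (stageY (X z.2) q.1 (stage W (X z.2) (σ z.2) (U z.2) q.1 q.2 z.1) t,
        stageS W (X z.2) q.1 (stage W (X z.2) (σ z.2) (U z.2) q.1 q.2 z.1) t) :=
    measurable_from_prod_countable_right fun j =>
      ((measurable_stageY hX hc (stages j) q.1).prodMk
        (measurable_stageS hW hX hc (stages j) q.1)).comp (measurable_prodMk_right (y := t))
  exact stage_value.comp (index.prodMk measurable_id)

theorem measurable_pathHat (hW : Continuous W) (hX : Measurable X) (hc : ∀ ω, IsCadlag (X ω))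
    (q : ℝ × ℝ) (t : ℝ≥0) : Measurable fun ω => pathHat W (X ω) q t := by
  have start : MeasurableStage fun _ : Ω => stage W 0 0 0 q.1 q.2 0 := measurableStage_const _
  simp only [pathHat_eq_stage_zero (σ := 0) (u := 0)]
  exact ((measurable_stageY hX hc start q.1).prodMk
    (measurable_stageS hW hX hc start q.1)).comp (measurable_prodMk_right (y := t))

end Measurability

/-! ### The first jump -/

section FirstJump

variable {Ω : Type*} {mΩ : MeasurableSpace Ω} {W : ℝ → ℝ} {K : ℝ} {X : Ω → ℝ≥0 → ℝ}
  {σ : Ω → ℕ → ℝ≥0}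

/-- The time `τ₁` of the first jump; it does not involve the jump heights. -/
def firstTime (W : ℝ → ℝ) (x : ℝ≥0 → ℝ) (σ : ℕ → ℝ≥0) (q : ℝ × ℝ) : ℝ≥0∞ :=
  stageEnd W x q.1 ⟨0, 0, q.2⟩ (σ 0) (σ 1)

/-- The position `(Y, S)(τ₁-)` just before the first jump. -/
def firstLeft (W : ℝ → ℝ) (x : ℝ≥0 → ℝ) (σ : ℕ → ℝ≥0) (q : ℝ × ℝ) : ℝ × ℝ :=
  (Function.leftLim (stageY x q.1 ⟨0, 0, q.2⟩) (firstTime W x σ q).toNNReal,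
    Function.leftLim (stageS W x q.1 ⟨0, 0, q.2⟩) (firstTime W x σ q).toNNReal)

/-- The height of the first jump, as a function of the uniform variable `v`. -/
def firstJump (W : ℝ → ℝ) (x : ℝ≥0 → ℝ) (σ : ℕ → ℝ≥0) (q : ℝ × ℝ) (v : ℝ) : ℝ :=
  jumpQuantile W (firstLeft W x σ q).1 (firstLeft W x σ q).2 v

theorem stage_one_jumps (x : ℝ≥0 → ℝ) (σ : ℕ → ℝ≥0) (u : ℕ → ℝ) (q : ℝ × ℝ) :
    (stage W x σ u q.1 q.2 1).jumps = firstJump W x σ q (u 0) :=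
  zero_add _

theorem measurable_firstTime (hW : Continuous W) (hK : ∀ x, |W x| ≤ K) (hX : Measurable X)
    (hc : ∀ ω, IsCadlag (X ω)) (hσ : Measurable σ) (q : ℝ × ℝ) :
    Measurable fun ω => firstTime W (X ω) (σ ω) q :=
  measurable_stageEnd hW hK hX hc (measurableStage_const _) q.1
    ((measurable_pi_apply 0).comp hσ) ((measurable_pi_apply 1).comp hσ)

theorem measurable_firstLeft (hW : Continuous W) (hK : ∀ x, |W x| ≤ K) (hX : Measurable X)
    (hc : ∀ ω, IsCadlag (X ω)) (hσ : Measurable σ) (q : ℝ × ℝ) :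
    Measurable fun ω => firstLeft W (X ω) (σ ω) q := by
  have time := (measurable_firstTime hW hK hX hc hσ q).ennreal_toNNReal
  exact (measurable_leftLim_stageY hX hc (measurableStage_const _) q.1 time).prodMk
    (measurable_leftLim_stageS hW hK hX hc (measurableStage_const _) q.1 time)

section Path

variable {x : ℝ≥0 → ℝ} {ζ : ℕ → ℝ≥0} {q : ℝ × ℝ} {t : ℝ≥0}

theorem abs_firstLeft_fst_sub_le (hx : IsCadlag x) {δ : ℝ} (hδ : ∀ r ≤ t, |x r| ≤ δ)
    (h : firstTime W x ζ q ≤ t) : |(firstLeft W x ζ q).1 - q.1| ≤ δ := by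
  refine abs_leftLim_sub_le ((hx.stageY q.1 _ _).2) fun r hr => ?_
  simpa only [stageY, add_zero, add_sub_cancel_left] using
    hδ r (hr.trans (ENNReal.toNNReal_mono ENNReal.coe_ne_top h))

theorem abs_firstLeft_snd_sub_le (hW : Continuous W) (hK : ∀ x, |W x| ≤ K) (hx : IsCadlag x)
    (h : firstTime W x ζ q ≤ t) : |(firstLeft W x ζ q).2 - q.2| ≤ K * t := by
  have K_nonneg : 0 ≤ K := (abs_nonneg (W 0)).trans (hK 0)
  refine abs_leftLim_sub_le ⟨_, (continuous_stageS hW hK hx).continuousWithinAt.tendsto⟩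
    fun r hr => (abs_stageS_sub_le (σ := ζ) (u := 0) hW hK hx 0 zero_le).trans
      (mul_le_mul_of_nonneg_left (NNReal.coe_le_coe.2
        (hr.trans (ENNReal.toNNReal_mono ENNReal.coe_ne_top h))) K_nonneg)

end Path

end FirstJump

/-! ### Small paths and regular drivers -/

section Probability

variable {Ω α β : Type*} {mΩ : MeasurableSpace Ω} {P : Measure Ω} {mα : MeasurableSpace α}
  {mβ : MeasurableSpace β}

theorem setIntegral_comp_prodMk_of_indepFun [IsFiniteMeasure P] {A : Ω → α} {V : Ω → β}
    (hA : Measurable A) (hV : Measurable V) (hAV : IndepFun A V P) {B : Set α}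
    (hB : MeasurableSet B) {Φ : α × β → ℝ} (hΦ : Measurable Φ) {C : ℝ} (hC : ∀ z, |Φ z| ≤ C) :
    ∫ ω in A ⁻¹' B, Φ (A ω, V ω) ∂P = ∫ ω in A ⁻¹' B, ∫ v, Φ (A ω, v) ∂(P.map V) ∂P := by
  have law : P.map (fun ω => (A ω, V ω)) = (P.map A).prod (P.map V) :=
    (indepFun_iff_map_prod_eq_prod_map_map hA.aemeasurable hV.aemeasurable).1 hAV
  have integrable : Integrable Φ ((P.map A).prod (P.map V)) :=
    .of_bound hΦ.aestronglyMeasurable C (.of_forall hC)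
  calc ∫ ω in A ⁻¹' B, Φ (A ω, V ω) ∂P
      = ∫ z in B ×ˢ univ, Φ z ∂((P.map A).prod (P.map V)) := by
        rw [← law, setIntegral_map (hB.prod .univ) hΦ.aestronglyMeasurable
          (hA.prodMk hV).aemeasurable, mk_preimage_prod, preimage_univ, inter_univ]
    _ = ∫ a in B, ∫ v, Φ (a, v) ∂(P.map V) ∂(P.map A) := by
        rw [setIntegral_prod _ integrable.integrableOn, Measure.restrict_univ]
    _ = ∫ ω in A ⁻¹' B, ∫ v, Φ (A ω, v) ∂(P.map V) ∂P :=
        setIntegral_map hB hΦ.stronglyMeasurable.integral_prod_right'.aestronglyMeasurable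
          hA.aemeasurable

theorem abs_setIntegral_le_of_le_of_le_off [IsFiniteMeasure P] {E B : Set Ω}
    (hB : MeasurableSet B) {F : Ω → ℝ} (hF : IntegrableOn F E P) {a b : ℝ} (ha : 0 ≤ a)
    (hb : 0 ≤ b) (ha' : ∀ ω ∈ E, ω ∉ B → |F ω| ≤ a) (hb' : ∀ ω ∈ E, |F ω| ≤ b) :
    |∫ ω in E, F ω ∂P| ≤ a * P.real E + b * P.real B := by
  rw [← integral_inter_add_sdiff hB hF, add_comm]
  refine (abs_add_le _ _).trans (add_le_add ?_ ?_)
  · exact (norm_setIntegral_le_of_norm_le_const (f := F) (measure_lt_top P _)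
      fun ω hω => ha' ω hω.1 hω.2).trans (mul_le_mul_of_nonneg_left
        (measureReal_mono sdiff_subset) ha)
  · exact (norm_setIntegral_le_of_norm_le_const (f := F) (measure_lt_top P _)
      fun ω hω => hb' ω hω.1).trans (mul_le_mul_of_nonneg_left
        (measureReal_mono inter_subset_right) hb)

end Probability

section SmallPaths

theorem le_of_forall_dense_le {f : ℝ≥0 → ℝ} (hf : ∀ t, ContinuousWithinAt f (Ici t) t)
    {D : Set ℝ≥0} (hD : Dense D) {c : ℝ} (h : ∀ r ∈ D, f r ≤ c) (t : ℝ≥0) : f t ≤ c := by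
  have accumulates : t ∈ closure (Ioi t ∩ D) := by
    have self_mem : t ∈ closure (Ioi t) := by simp only [closure_Ioi, self_mem_Ici]
    exact closure_minimal (hD.open_subset_closure_inter isOpen_Ioi) isClosed_closure self_mem
  have right : ContinuousWithinAt f (Ioi t ∩ D) t :=
    (hf t).mono (inter_subset_left.trans Ioi_subset_Ici_self)
  have image_subset : f '' (Ioi t ∩ D) ⊆ Iic c := image_subset_iff.2 fun r hr => h r hr.2
  exact closure_minimal image_subset isClosed_Iic (right.mem_closure_image accumulates)

/-- Paths bounded by `δ` on `[0, t]`, as far as a countable set of times can tell: this set is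
measurable, and for a càdlàg path membership is the bound at all times. -/
def smallPaths (δ : ℝ) (t : ℝ≥0) : Set (ℝ≥0 → ℝ) :=
  {x | ∀ k, |x (min (TopologicalSpace.denseSeq ℝ≥0 k) t)| ≤ δ}

theorem measurableSet_smallPaths (δ : ℝ) (t : ℝ≥0) : MeasurableSet (smallPaths δ t) := by
  simp only [smallPaths, ofPred_forall]
  exact .iInter fun k => measurableSet_le (measurable_pi_apply _).abs measurable_const

theorem IsCadlag.mem_smallPaths_iff {x : ℝ≥0 → ℝ} (hx : IsCadlag x) {δ : ℝ} {t : ℝ≥0} :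
    x ∈ smallPaths δ t ↔ ∀ r ≤ t, |x r| ≤ δ := by
  refine ⟨fun h r hr => ?_, fun h k => h _ (min_le_right _ _)⟩
  have stopped (r : ℝ≥0) : ContinuousWithinAt (fun r => |x (min r t)|) (Ici r) r :=
    ((hx (min r t)).1.comp (f := fun r => min r t)
      (continuous_id.min continuous_const).continuousWithinAt
      fun r' hr' => min_le_min_right t hr').abs
  simpa only [min_eq_left hr] using
    le_of_forall_dense_le stopped (TopologicalSpace.denseRange_denseSeq ℝ≥0) (c := δ)
      (forall_mem_range.2 h) r

theorem IsCadlag.exists_mem_smallPaths {x : ℝ≥0 → ℝ} (hx : IsCadlag x) (h0 : x 0 = 0) {δ : ℝ}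
    (hδ : 0 < δ) : ∃ t > 0, x ∈ smallPaths δ t := by
  have near : ∀ᶠ r in 𝓝[≥] 0, |x r| < δ :=
    (hx 0).1.abs.tendsto.eventually_lt_const (by rwa [h0, abs_zero])
  obtain ⟨c, hc, hsub⟩ := mem_nhdsGE_iff_exists_Ico_subset.1 near
  refine ⟨c / 2, half_pos hc, hx.mem_smallPaths_iff.2 fun r hr => ?_⟩
  exact (hsub ⟨zero_le, hr.trans_lt (NNReal.half_lt_self (ne_of_gt hc))⟩).le

theorem tendsto_measureReal_notMem_smallPaths {Ω : Type*} {mΩ : MeasurableSpace Ω}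
    {P : Measure Ω} [IsFiniteMeasure P] {X : Ω → ℝ≥0 → ℝ} (hX : Measurable X)
    (hc : ∀ ω, IsCadlag (X ω)) (h0 : ∀ ω, X ω 0 = 0) {δ : ℝ} (hδ : 0 < δ) :
    Tendsto (fun t => P.real {ω | X ω ∉ smallPaths δ t}) (𝓝[>] 0) (𝓝 0) := by
  have inter_eq_empty : ⋂ t > 0, {ω | X ω ∉ smallPaths δ t} = ∅ := by
    refine eq_empty_of_forall_notMem fun ω hω => ?_
    obtain ⟨t, ht, hmem⟩ := (hc ω).exists_mem_smallPaths (h0 ω) hδ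
    exact mem_iInter₂.1 hω t ht hmem
  have limit : Tendsto (fun t => P {ω | X ω ∉ smallPaths δ t}) (𝓝[>] 0) (𝓝 0) := by
    rw [← measure_empty (μ := P), ← inter_eq_empty]
    refine tendsto_measure_biInter_gt
      (fun t _ => (hX (measurableSet_smallPaths δ t).compl).nullMeasurableSet)
      (fun t t' _ htt' ω hω hmem => hω ?_) ⟨1, one_pos, measure_ne_top _ _⟩
    rw [(hc ω).mem_smallPaths_iff] at hmem ⊢
    exact fun r hr => hmem r (hr.trans htt')
  exact (ENNReal.tendsto_toReal ENNReal.zero_ne_top).comp limit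

end SmallPaths

/-- Driving processes all of whose paths are regular: `X` is càdlàg from `0`, `σ` is the sequence
of jump times of a Poisson process, of which only small-time estimates are recorded, and `U 0` is
uniform. -/
structure RegularDrivers {Ω : Type*} [MeasurableSpace Ω] (P : Measure Ω) (X : Ω → ℝ≥0 → ℝ)
    (σ : Ω → ℕ → ℝ≥0) (U : Ω → ℕ → ℝ) : Prop where
  measurable_X : Measurable X
  cadlag : ∀ ω, IsCadlag (X ω)
  start : ∀ ω, X ω 0 = 0
  measurable_σ : Measurable σ
  σ_zero : ∀ ω, σ ω 0 = 0
  measurable_U : Measurable U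
  law_U : P.map (fun ω => U ω 0) = (volume : Measure ℝ).restrict (Ioo 0 1)
  indep_X_σ : IndepFun X σ P
  indep_U : IndepFun (fun ω => (X ω, σ ω)) (fun ω => U ω 0) P
  first_le : ∀ a : ℝ, 0 ≤ a → P.real {ω | (σ ω 1 : ℝ) ≤ a} ≤ a
  le_first : ∀ a : ℝ, 0 ≤ a → a - a ^ 2 ≤ P.real {ω | (σ ω 1 : ℝ) ≤ a}
  second_le : ∀ a : ℝ, 0 ≤ a → P.real {ω | (σ ω 2 : ℝ) ≤ a} ≤ a ^ 2

/-- The event that the first jump happens by time `t`. -/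
def jumpEvent {Ω : Type*} (W : ℝ → ℝ) (X : Ω → ℝ≥0 → ℝ) (σ : Ω → ℕ → ℝ≥0) (q : ℝ × ℝ)
    (t : ℝ≥0) : Set Ω :=
  {ω | firstTime W (X ω) (σ ω) q ≤ t}

namespace RegularDrivers

variable {Ω : Type*} {mΩ : MeasurableSpace Ω} {P : Measure Ω} {W : ℝ → ℝ} {K : ℝ}
  {X : Ω → ℝ≥0 → ℝ} {σ : Ω → ℕ → ℝ≥0} {U : Ω → ℕ → ℝ} {q : ℝ × ℝ} {t : ℝ≥0}

theorem measurableSet_σ_le (D : RegularDrivers P X σ U) (k : ℕ) (a : ℝ) :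
    MeasurableSet {ω | (σ ω k : ℝ) ≤ a} :=
  measurableSet_le (measurable_coe_nnreal_real.comp ((measurable_pi_apply k).comp D.measurable_σ))
    measurable_const

theorem measurable_firstLeft_firstTime (D : RegularDrivers P X σ U) (hW : Continuous W)
    (hK : ∀ x, |W x| ≤ K) (q : ℝ × ℝ) :
    Measurable fun ω => (firstLeft W (X ω) (σ ω) q, firstTime W (X ω) (σ ω) q) :=
  (measurable_firstLeft hW hK D.measurable_X D.cadlag D.measurable_σ q).prodMk
    (measurable_firstTime hW hK D.measurable_X D.cadlag D.measurable_σ q)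

theorem indepFun_firstLeft_firstTime (D : RegularDrivers P X σ U) (hW : Continuous W)
    (hK : ∀ x, |W x| ≤ K) (q : ℝ × ℝ) :
    IndepFun (fun ω => (firstLeft W (X ω) (σ ω) q, firstTime W (X ω) (σ ω) q))
      (fun ω => U ω 0) P := by
  let drivers : Ω → (ℝ≥0 → ℝ) × (ℕ → ℝ≥0) := fun ω => (X ω, σ ω)
  have X_measurable : Measurable[.comap drivers inferInstance] X :=
    measurable_fst.comp (comap_measurable drivers)
  have σ_measurable : Measurable[.comap drivers inferInstance] σ :=
    measurable_snd.comp (comap_measurable drivers)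
  have adapted : Measurable[.comap drivers inferInstance] fun ω =>
      (firstLeft W (X ω) (σ ω) q, firstTime W (X ω) (σ ω) q) :=
    (measurable_firstLeft (mΩ := .comap drivers inferInstance) hW hK X_measurable D.cadlag
      σ_measurable q).prodMk (measurable_firstTime (mΩ := .comap drivers inferInstance) hW hK
        X_measurable D.cadlag σ_measurable q)
  rw [IndepFun_iff_Indep]
  exact indep_of_indep_of_le_left ((IndepFun_iff_Indep _ _ _).1 D.indep_U) adapted.comap_le

theorem setIntegral_firstJump [IsFiniteMeasure P] (D : RegularDrivers P X σ U)
    (hW : Continuous W) (hK : ∀ x, |W x| ≤ K) {h : ℝ → ℝ} (hh : Measurable h) {H : ℝ}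
    (hH : ∀ x, |h x| ≤ H) (q : ℝ × ℝ) (t : ℝ≥0) :
    ∫ ω in jumpEvent W X σ q t, h (firstJump W (X ω) (σ ω) q (U ω 0)) ∂P =
      ∫ ω in jumpEvent W X σ q t, (∫ v in Ioo (0 : ℝ) 1, h (firstJump W (X ω) (σ ω) q v)) ∂P := by
  rw [← D.law_U]
  exact setIntegral_comp_prodMk_of_indepFun
    (Φ := fun z => h (jumpQuantile W z.1.1.1 z.1.1.2 z.2))
    (D.measurable_firstLeft_firstTime hW hK q) ((measurable_pi_apply 0).comp D.measurable_U)
    (D.indepFun_firstLeft_firstTime hW hK q) (measurableSet_le measurable_snd measurable_const)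
    (hh.comp ((measurable_jumpQuantile hW).comp
      ((measurable_fst.comp measurable_fst).prodMk measurable_snd))) fun _ => hH _

end RegularDrivers

/-! ### The first jump in small time -/

/-- Control of the jump mechanism around the starting point `q`: on the memory values that can be
reached by time `t` the jump rate is at most `Λ`, and as long as the position is within `δ` of
`q.1` the jump density is `ε`-close in `L¹` to the one at `q`. -/
structure LocalControl (W : ℝ → ℝ) (K : ℝ) (q : ℝ × ℝ) (t : ℝ≥0) (δ ε Λ : ℝ) : Prop where
  density : ∀ y s, |y - q.1| ≤ δ → |s - q.2| ≤ K * t →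
    ∫ x, |g W y s x - g W q.1 q.2 x| ≤ ε
  rate : ∀ y s, |s - q.2| ≤ K * t → gNorm W y s ≤ Λ

theorem abs_setIntegral_Ioo_zero_one_le {f : ℝ → ℝ} {H : ℝ} (hH : ∀ v, |f v| ≤ H) :
    |∫ v in Ioo (0 : ℝ) 1, f v| ≤ H := by
  simpa using norm_setIntegral_le_of_norm_le_const (f := f) (μ := volume) (s := Ioo (0 : ℝ) 1)
    measure_Ioo_lt_top fun v _ => hH v

namespace LocalControl

variable {W : ℝ → ℝ} {K : ℝ} {q : ℝ × ℝ} {t : ℝ≥0} {δ ε Λ : ℝ} {x : ℝ≥0 → ℝ} {ζ : ℕ → ℝ≥0}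

theorem abs_gNorm_sub_le (L : LocalControl W K q t δ ε Λ) (hW : Continuous W) {y s : ℝ}
    (hy : |y - q.1| ≤ δ) (hs : |s - q.2| ≤ K * t) : |gNorm W y s - gNorm W q.1 q.2| ≤ ε :=
  (MemoryJump.abs_gNorm_sub_le hW _ _ _ _).trans (L.density y s hy hs)

theorem gNorm_le (L : LocalControl W K q t δ ε Λ) (hK : ∀ x, |W x| ≤ K) :
    gNorm W q.1 q.2 ≤ Λ :=
  L.rate _ _ (by
    rw [sub_self, abs_zero]
    exact mul_nonneg ((abs_nonneg (W 0)).trans (hK 0)) t.coe_nonneg)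

theorem rate_nonneg (L : LocalControl W K q t δ ε Λ) (hK : ∀ x, |W x| ≤ K) : 0 ≤ Λ :=
  (gNorm_nonneg _ _).trans (L.gNorm_le hK)

theorem abs_gNorm_pathHat_sub_le (L : LocalControl W K q t δ ε Λ) (hW : Continuous W)
    (hK : ∀ x, |W x| ≤ K) (hδ : ∀ r ≤ t, |x r| ≤ δ) (r : ℝ≥0) (hr : r ≤ t) :
    |gNorm W (pathHat W x q r).1 (pathHat W x q r).2 - gNorm W q.1 q.2| ≤ ε := by
  refine L.abs_gNorm_sub_le hW ?_ ((abs_pathHat_snd_sub_le hK).trans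
    (mul_le_mul_of_nonneg_left (NNReal.coe_le_coe.2 hr) ((abs_nonneg (W 0)).trans (hK 0))))
  simpa only [pathHat, add_sub_cancel_left] using hδ r hr

theorem le_of_stage_time_le (L : LocalControl W K q t δ ε Λ) (hW : Continuous W)
    (hK : ∀ x, |W x| ≤ K) (hx : IsCadlag x) (hζ : ζ 0 = 0) {u : ℕ → ℝ} {j : ℕ}
    (h : (stage W x ζ u q.1 q.2 j).time ≤ t) : (ζ j : ℝ) ≤ Λ * t :=
  (le_mul_of_stage_time_le hW hK hx hζ L.rate j h).trans
    (mul_le_mul_of_nonneg_left (ENNReal.toReal_le_coe_of_le_coe h) (L.rate_nonneg hK))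

theorem le_of_firstTime_le (L : LocalControl W K q t δ ε Λ) (hW : Continuous W)
    (hK : ∀ x, |W x| ≤ K) (hx : IsCadlag x) (hζ : ζ 0 = 0) (h : firstTime W x ζ q ≤ t) :
    (ζ 1 : ℝ) ≤ Λ * t :=
  L.le_of_stage_time_le (u := 0) (j := 1) hW hK hx hζ h

theorem abs_gNorm_mul_integral_firstJump_sub_le (L : LocalControl W K q t δ ε Λ)
    (hW : Continuous W) (hK : ∀ x, |W x| ≤ K) (hx : IsCadlag x) (hδ : ∀ r ≤ t, |x r| ≤ δ)
    (h : firstTime W x ζ q ≤ t) {f : ℝ → ℝ} (hf : Continuous f) {H : ℝ} (hH : ∀ x, |f x| ≤ H) :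
    |gNorm W q.1 q.2 * (∫ v in Ioo (0 : ℝ) 1, f (firstJump W x ζ q v)) -
      ∫ x, f x * g W q.1 q.2 x| ≤ 2 * H * ε := by
  set p := firstLeft W x ζ q
  set mean := ∫ v in Ioo (0 : ℝ) 1, f (firstJump W x ζ q v)
  have position := abs_firstLeft_fst_sub_le hx hδ h
  have memory := abs_firstLeft_snd_sub_le hW hK hx h
  have mean_le : |mean| ≤ H := abs_setIntegral_Ioo_zero_one_le fun _ => hH _
  have integrals_close : |mean * gNorm W p.1 p.2 - ∫ x, f x * g W q.1 q.2 x| ≤ H * ε := by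
    refine (congrArg (fun I => |I - _|) (integral_jumpQuantile_mul_gNorm hW hf p.1 p.2)).trans_le
      ((abs_integral_mul_g_sub_le hW hf hH _ _ _ _).trans
        (mul_le_mul_of_nonneg_left (L.density _ _ position memory) ?_))
    exact (abs_nonneg _).trans (hH 0)
  have rates_close : |mean * (gNorm W p.1 p.2 - gNorm W q.1 q.2)| ≤ H * ε := by
    rw [abs_mul]
    exact mul_le_mul mean_le (L.abs_gNorm_sub_le hW position memory) (abs_nonneg _)
      ((abs_nonneg _).trans mean_le)
  calc |gNorm W q.1 q.2 * mean - ∫ x, f x * g W q.1 q.2 x|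
      = |(mean * gNorm W p.1 p.2 - ∫ x, f x * g W q.1 q.2 x) -
          mean * (gNorm W p.1 p.2 - gNorm W q.1 q.2)| := by congr 1; ring
    _ ≤ H * ε + H * ε := (abs_sub _ _).trans (add_le_add integrals_close rates_close)
    _ = 2 * H * ε := by ring

end LocalControl

theorem abs_sub_mul_le_of_approx_rate {G H I Ψ c t ε β l : ℝ} (hG : 0 ≤ G) (hH : 0 ≤ H)
    (ht : 0 ≤ t) (hε : 0 ≤ ε) (hβ : 0 ≤ β) (hl : 0 ≤ l) (hΨ : |Ψ| ≤ H * G) (hI : |I| ≤ H * c)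
    (hc : c ≤ (G + ε) * t + β) (hc' : G * t - ε * t - l - β ≤ c)
    (h : |G * I - Ψ * c| ≤ 2 * H * ε * c + 2 * H * G * β) :
    |I - t * Ψ| ≤ H * (5 * ε * t + 5 * β + l) := by
  rcases le_or_gt G ε with small | large
  · have Ψ_le : |t * Ψ| ≤ t * (H * ε) := by
      rw [abs_mul, abs_of_nonneg ht]
      exact mul_le_mul_of_nonneg_left (hΨ.trans (mul_le_mul_of_nonneg_left small hH)) ht
    have c_le : c ≤ 2 * ε * t + β := hc.trans (by nlinarith)
    calc |I - t * Ψ| ≤ H * c + t * (H * ε) := (abs_sub _ _).trans (add_le_add hI Ψ_le)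
      _ ≤ H * (2 * ε * t + β) + t * (H * ε) := by gcongr
      _ ≤ H * (5 * ε * t + 5 * β + l) := by
        have : 0 ≤ H * (2 * (ε * t) + 4 * β + l) := by positivity
        linarith
  · have c_close : |c - G * t| ≤ ε * t + l + β := abs_le.2 ⟨by linarith, by linarith⟩
    have ε_mul_c_le : ε * c ≤ 2 * G * ε * t + G * β :=
      calc ε * c ≤ ε * ((G + ε) * t + β) := by gcongr
        _ ≤ ε * ((G + G) * t) + G * β := by rw [mul_add]; gcongr
        _ = 2 * G * ε * t + G * β := by ring
    refine le_of_mul_le_mul_left ?_ (hε.trans_lt large)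
    calc G * |I - t * Ψ| = |(G * I - Ψ * c) + Ψ * (c - G * t)| := by
          rw [← abs_of_nonneg hG, ← abs_mul, abs_of_nonneg hG]; congr 1; ring
      _ ≤ (2 * H * ε * c + 2 * H * G * β) + H * G * (ε * t + l + β) := by
          refine (abs_add_le _ _).trans (add_le_add h ?_)
          rw [abs_mul]
          gcongr
      _ = 2 * H * (ε * c) + 2 * H * G * β + H * G * (ε * t + l + β) := by ring
      _ ≤ 2 * H * (2 * G * ε * t + G * β) + 2 * H * G * β + H * G * (ε * t + l + β) := by
          gcongr
      _ = G * (H * (5 * ε * t + 5 * β + l)) := by ring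

/-- The event that the path leaves `[-δ, δ]` by time `t` although the clock `σ 1` rings before
`Λ t`. Outside of it, a first jump by time `t` starts within `δ` of the starting position. -/
def badEvent {Ω : Type*} (X : Ω → ℝ≥0 → ℝ) (σ : Ω → ℕ → ℝ≥0) (δ : ℝ) (t : ℝ≥0) (Λ : ℝ) : Set Ω :=
  {ω | X ω ∉ smallPaths δ t ∧ (σ ω 1 : ℝ) ≤ Λ * t}

namespace RegularDrivers

variable {Ω : Type*} {mΩ : MeasurableSpace Ω} {P : Measure Ω} {W : ℝ → ℝ} {K : ℝ}
  {X : Ω → ℝ≥0 → ℝ} {σ : Ω → ℕ → ℝ≥0} {U : Ω → ℕ → ℝ} {q : ℝ × ℝ} {t : ℝ≥0} {δ ε Λ : ℝ}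

theorem measurableSet_badEvent (D : RegularDrivers P X σ U) (δ : ℝ) (t : ℝ≥0) (Λ : ℝ) :
    MeasurableSet (badEvent X σ δ t Λ) :=
  (D.measurable_X (measurableSet_smallPaths δ t).compl).inter (D.measurableSet_σ_le 1 _)

theorem measureReal_badEvent_le (D : RegularDrivers P X σ U) (δ : ℝ) (t : ℝ≥0) (hΛ : 0 ≤ Λ) :
    P.real (badEvent X σ δ t Λ) ≤ P.real {ω | X ω ∉ smallPaths δ t} * (Λ * t) := by
  have clock : MeasurableSet {z : ℕ → ℝ≥0 | (z 1 : ℝ) ≤ Λ * t} :=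
    measurableSet_le (measurable_coe_nnreal_real.comp (measurable_pi_apply 1)) measurable_const
  have independent : P.real (badEvent X σ δ t Λ) =
      P.real {ω | X ω ∉ smallPaths δ t} * P.real {ω | (σ ω 1 : ℝ) ≤ Λ * t} := by
    simp only [Measure.real, ← ENNReal.toReal_mul]
    exact congrArg ENNReal.toReal
      (D.indep_X_σ.measure_inter_preimage_eq_mul _ _ (measurableSet_smallPaths δ t).compl clock)
  rw [independent]
  exact mul_le_mul_of_nonneg_left (D.first_le _ (mul_nonneg hΛ t.coe_nonneg)) measureReal_nonneg

theorem jumpEvent_subset_badEvent_union (D : RegularDrivers P X σ U) (hW : Continuous W)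
    (hK : ∀ x, |W x| ≤ K) (L : LocalControl W K q t δ ε Λ) :
    jumpEvent W X σ q t ⊆
      badEvent X σ δ t Λ ∪ {ω | (σ ω 1 : ℝ) ≤ (gNorm W q.1 q.2 + ε) * t} := by
  intro ω jumps
  by_cases small : X ω ∈ smallPaths δ t
  · exact .inr (le_of_stage_one_time_le (u := U ω) hW hK (D.cadlag ω) (D.σ_zero ω)
      (L.abs_gNorm_pathHat_sub_le hW hK ((D.cadlag ω).mem_smallPaths_iff.1 small)) jumps)
  · exact .inl ⟨small, L.le_of_firstTime_le hW hK (D.cadlag ω) (D.σ_zero ω) jumps⟩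

theorem setOf_le_subset_badEvent_union (D : RegularDrivers P X σ U) (hW : Continuous W)
    (hK : ∀ x, |W x| ≤ K) (L : LocalControl W K q t δ ε Λ) (hε : 0 ≤ ε) :
    {ω | (σ ω 1 : ℝ) ≤ (gNorm W q.1 q.2 - ε) * t} ⊆
      badEvent X σ δ t Λ ∪ jumpEvent W X σ q t := by
  intro ω rings
  by_cases small : X ω ∈ smallPaths δ t
  · exact .inr (stage_one_time_le_of_le (u := U ω) hW hK (D.cadlag ω) (D.σ_zero ω)
      (L.abs_gNorm_pathHat_sub_le hW hK ((D.cadlag ω).mem_smallPaths_iff.1 small)) rings)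
  · exact .inl ⟨small, rings.trans (mul_le_mul_of_nonneg_right
      (by linarith [L.gNorm_le hK]) t.coe_nonneg)⟩

theorem measureReal_jumpEvent_le [IsFiniteMeasure P] (D : RegularDrivers P X σ U)
    (hW : Continuous W) (hK : ∀ x, |W x| ≤ K) (L : LocalControl W K q t δ ε Λ) (hε : 0 ≤ ε) :
    P.real (jumpEvent W X σ q t) ≤
      (gNorm W q.1 q.2 + ε) * t + P.real (badEvent X σ δ t Λ) := by
  rw [add_comm]
  refine (measureReal_mono (D.jumpEvent_subset_badEvent_union hW hK L)).trans
    ((measureReal_union_le _ _).trans (add_le_add_right (D.first_le _ ?_) _))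
  exact mul_nonneg (add_nonneg (gNorm_nonneg _ _) hε) t.coe_nonneg

theorem le_measureReal_jumpEvent [IsFiniteMeasure P] (D : RegularDrivers P X σ U)
    (hW : Continuous W) (hK : ∀ x, |W x| ≤ K) (L : LocalControl W K q t δ ε Λ) (hε : 0 ≤ ε) :
    gNorm W q.1 q.2 * t - ε * t - (Λ * t) ^ 2 - P.real (badEvent X σ δ t Λ) ≤
      P.real (jumpEvent W X σ q t) := by
  have ht := t.coe_nonneg
  rcases le_or_gt (gNorm W q.1 q.2) ε with small | large
  · linarith [mul_le_mul_of_nonneg_right small ht, sq_nonneg (Λ * t),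
      measureReal_nonneg (μ := P) (s := badEvent X σ δ t Λ),
      measureReal_nonneg (μ := P) (s := jumpEvent W X σ q t)]
  · set a := (gNorm W q.1 q.2 - ε) * t
    have a_nonneg : 0 ≤ a := mul_nonneg (sub_nonneg.2 large.le) ht
    have a_le : a ≤ Λ * t := mul_le_mul_of_nonneg_right (by linarith [L.gNorm_le hK]) ht
    have ring_le := (D.le_first a a_nonneg).trans ((measureReal_mono
      (D.setOf_le_subset_badEvent_union hW hK L hε)).trans (measureReal_union_le _ _))
    linarith [pow_le_pow_left₀ a_nonneg a_le 2, sub_mul (gNorm W q.1 q.2) ε t]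

theorem integrable_integral_firstJump [IsFiniteMeasure P] (D : RegularDrivers P X σ U)
    (hW : Continuous W) (hK : ∀ x, |W x| ≤ K) {h : ℝ → ℝ} (hh : Measurable h) {H : ℝ}
    (hH : ∀ x, |h x| ≤ H) (q : ℝ × ℝ) :
    Integrable (fun ω => ∫ v in Ioo (0 : ℝ) 1, h (firstJump W (X ω) (σ ω) q v)) P := by
  have average : Measurable fun p : ℝ × ℝ => ∫ v in Ioo (0 : ℝ) 1, h (jumpQuantile W p.1 p.2 v) :=
    (StronglyMeasurable.integral_prod_right'
      (hh.comp (measurable_jumpQuantile hW)).stronglyMeasurable).measurable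
  have measurable_mean : Measurable fun ω =>
      ∫ v in Ioo (0 : ℝ) 1, h (firstJump W (X ω) (σ ω) q v) :=
    average.comp (measurable_firstLeft hW hK D.measurable_X D.cadlag D.measurable_σ q)
  exact .of_bound measurable_mean.aestronglyMeasurable H
    (.of_forall fun _ => abs_setIntegral_Ioo_zero_one_le fun _ => hH _)

theorem abs_gNorm_mul_setIntegral_firstJump_sub_le [IsFiniteMeasure P]
    (D : RegularDrivers P X σ U) (hW : Continuous W) (hK : ∀ x, |W x| ≤ K)
    (L : LocalControl W K q t δ ε Λ) (hε : 0 ≤ ε) {h : ℝ → ℝ} (hh : Continuous h) {H : ℝ}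
    (hH : ∀ x, |h x| ≤ H) :
    |gNorm W q.1 q.2 *
          (∫ ω in jumpEvent W X σ q t, h (firstJump W (X ω) (σ ω) q (U ω 0)) ∂P) -
        (∫ x, h x * g W q.1 q.2 x) * P.real (jumpEvent W X σ q t)| ≤
      2 * H * ε * P.real (jumpEvent W X σ q t) +
        2 * H * gNorm W q.1 q.2 * P.real (badEvent X σ δ t Λ) := by
  set mean : Ω → ℝ := fun ω => ∫ v in Ioo (0 : ℝ) 1, h (firstJump W (X ω) (σ ω) q v)
  set G := gNorm W q.1 q.2
  set Ψ := ∫ x, h x * g W q.1 q.2 x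
  have hG : 0 ≤ G := gNorm_nonneg _ _
  have hH0 : 0 ≤ H := (abs_nonneg _).trans (hH 0)
  have mean_le (ω : Ω) : |mean ω| ≤ H := abs_setIntegral_Ioo_zero_one_le fun _ => hH _
  have mean_integrable : Integrable mean P :=
    D.integrable_integral_firstJump hW hK hh.measurable hH q
  have integral_eq : G * (∫ ω in jumpEvent W X σ q t, mean ω ∂P) -
      Ψ * P.real (jumpEvent W X σ q t) = ∫ ω in jumpEvent W X σ q t, (G * mean ω - Ψ) ∂P := by
    rw [integral_sub (mean_integrable.const_mul G).integrableOn (integrable_const _).integrableOn,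
      integral_const_mul, setIntegral_const, smul_eq_mul, mul_comm Ψ]
  rw [D.setIntegral_firstJump hW hK hh.measurable hH, integral_eq]
  refine abs_setIntegral_le_of_le_of_le_off (D.measurableSet_badEvent δ t Λ)
    ((mean_integrable.const_mul G).sub (integrable_const Ψ)).integrableOn (by positivity)
    (by positivity) (fun ω jumps good => ?_) fun ω _ => ?_
  · have small : X ω ∈ smallPaths δ t := by_contra fun small =>
      good ⟨small, L.le_of_firstTime_le hW hK (D.cadlag ω) (D.σ_zero ω) jumps⟩
    exact L.abs_gNorm_mul_integral_firstJump_sub_le hW hK (D.cadlag ω)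
      ((D.cadlag ω).mem_smallPaths_iff.1 small) jumps hh hH
  · calc |G * mean ω - Ψ| ≤ G * |mean ω| + |Ψ| := by
          simpa only [abs_mul, abs_of_nonneg hG] using abs_sub (G * mean ω) Ψ
      _ ≤ G * H + H * G := by gcongr; exacts [mean_le ω, abs_integral_mul_g_le hW hH _ _]
      _ = 2 * H * G := by ring

theorem abs_setIntegral_firstJump_sub_le [IsFiniteMeasure P] (D : RegularDrivers P X σ U)
    (hW : Continuous W) (hK : ∀ x, |W x| ≤ K) (L : LocalControl W K q t δ ε Λ) (hε : 0 ≤ ε)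
    {h : ℝ → ℝ} (hh : Continuous h) {H : ℝ} (hH : ∀ x, |h x| ≤ H) :
    |(∫ ω in jumpEvent W X σ q t, h (firstJump W (X ω) (σ ω) q (U ω 0)) ∂P) -
        t * ∫ x, h x * g W q.1 q.2 x| ≤
      H * (5 * ε * t + 5 * P.real (badEvent X σ δ t Λ) + (Λ * t) ^ 2) :=
  abs_sub_mul_le_of_approx_rate (gNorm_nonneg _ _) ((abs_nonneg _).trans (hH 0)) t.coe_nonneg hε
    measureReal_nonneg (sq_nonneg _) (abs_integral_mul_g_le hW hH _ _)
    (norm_setIntegral_le_of_norm_le_const (f := fun ω => h (firstJump W (X ω) (σ ω) q (U ω 0)))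
      (measure_lt_top P _) fun _ _ => hH _)
    (D.measureReal_jumpEvent_le hW hK L hε) (D.le_measureReal_jumpEvent hW hK L hε)
    (D.abs_gNorm_mul_setIntegral_firstJump_sub_le hW hK L hε hh hH)

end RegularDrivers

/-! ### Comparison with the jump-free process -/

section Comparison

variable {W : ℝ → ℝ} {K δ ε w F : ℝ} {f : ℝ × ℝ → ℝ} {q : ℝ × ℝ} {t : ℝ≥0}

theorem jumpOp_eq_integral_mul_g (W : ℝ → ℝ) (f : ℝ × ℝ → ℝ) (q : ℝ × ℝ) :
    jumpOp W f q = ∫ x, (f (q.1 + x, q.2) - f q) * g W q.1 q.2 x := by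
  rw [integral_mul_g, jumpOp, intervalIntegral.integral_comp_add_left
    (f := fun x => (f (x, q.2) - f q) * max ((W q.1 - W x) * q.2) 0), add_comm q.1, add_comm q.1,
    neg_add_eq_sub]

theorem jumpOp_eq_zero (h : ∀ x, f (x, q.2) = 0) : jumpOp W f q = 0 := by
  simp only [jumpOp, h, sub_zero, zero_mul, intervalIntegral.integral_zero]

theorem abs_sub_le_two_mul_of_abs_le (hF : ∀ z, |f z| ≤ F) (a b : ℝ × ℝ) :
    |f a - f b| ≤ 2 * F := by
  linarith [abs_sub (f a) (f b), hF a, hF b]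

theorem abs_pathYS_sub_pathHat_sub_firstJump_le {x : ℝ≥0 → ℝ} {ζ : ℕ → ℝ≥0} {u : ℕ → ℝ}
    (hW : Continuous W) (hK : ∀ y, |W y| ≤ K) (hx : IsCadlag x) (hδ : |x t| ≤ δ)
    (hw : ∀ a b : ℝ × ℝ, |a.1 - b.1| ≤ δ → |a.2 - b.2| ≤ K * t → |f a - f b| ≤ w)
    (h₁ : firstTime W x ζ q ≤ t) (h₂ : (t : ℝ≥0∞) < (stage W x ζ u q.1 q.2 2).time) :
    |f (pathYS W x ζ u q t) - f (pathHat W x q t) -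
      (f (q.1 + firstJump W x ζ q (u 0), q.2) - f q)| ≤ 2 * w := by
  have jumped : |f (pathYS W x ζ u q t) - f (q.1 + firstJump W x ζ q (u 0), q.2)| ≤ w := by
    refine hw _ _ ?_ (abs_pathYS_snd_sub_le hW hK hx)
    rw [pathYS_fst_of_one_jump h₁ h₂, stage_one_jumps, add_right_comm, add_sub_cancel_left]
    exact hδ
  have unjumped : |f (pathHat W x q t) - f q| ≤ w := by
    refine hw _ _ ?_ (abs_pathHat_snd_sub_le hK)
    rw [pathHat, add_sub_cancel_left]
    exact hδ
  rw [sub_sub_sub_comm, two_mul]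
  exact (abs_sub _ _).trans (add_le_add jumped unjumped)

namespace RegularDrivers

variable {Ω : Type*} {mΩ : MeasurableSpace Ω} {P : Measure Ω} {X : Ω → ℝ≥0 → ℝ}
  {σ : Ω → ℕ → ℝ≥0} {U : Ω → ℕ → ℝ} {Λ : ℝ}

theorem integrable_comp_pathYS [IsFiniteMeasure P] (D : RegularDrivers P X σ U)
    (hW : Continuous W) (hK : ∀ x, |W x| ≤ K) (hf : Continuous f) (hF : ∀ z, |f z| ≤ F)
    (q : ℝ × ℝ) (t : ℝ≥0) : Integrable (fun ω => f (pathYS W (X ω) (σ ω) (U ω) q t)) P :=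
  .of_bound (hf.measurable.comp (measurable_pathYS hW hK D.measurable_X D.cadlag D.measurable_σ
    D.measurable_U q t)).aestronglyMeasurable F (.of_forall fun _ => hF _)

theorem integrable_comp_pathHat [IsFiniteMeasure P] (D : RegularDrivers P X σ U)
    (hW : Continuous W) (hf : Continuous f) (hF : ∀ z, |f z| ≤ F) (q : ℝ × ℝ) (t : ℝ≥0) :
    Integrable (fun ω => f (pathHat W (X ω) q t)) P :=
  .of_bound (hf.measurable.comp (measurable_pathHat hW D.measurable_X D.cadlag
    q t)).aestronglyMeasurable F (.of_forall fun _ => hF _)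

theorem integrable_firstJump [IsFiniteMeasure P] (D : RegularDrivers P X σ U)
    (hW : Continuous W) (hK : ∀ x, |W x| ≤ K) (hf : Continuous f) (hF : ∀ z, |f z| ≤ F)
    (q : ℝ × ℝ) :
    Integrable (fun ω => f (q.1 + firstJump W (X ω) (σ ω) q (U ω 0), q.2) - f q) P := by
  have jump := (measurable_jumpQuantile hW).comp
    ((measurable_firstLeft hW hK D.measurable_X D.cadlag D.measurable_σ q).prodMk
      ((measurable_pi_apply 0).comp D.measurable_U))
  exact .of_bound ((hf.measurable.comp ((jump.const_add q.1).prodMk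
    measurable_const)).sub_const _).aestronglyMeasurable (2 * F)
    (.of_forall fun _ => abs_sub_le_two_mul_of_abs_le hF _ _)

theorem setIntegral_jumpEvent_sub [IsFiniteMeasure P] (D : RegularDrivers P X σ U)
    (hW : Continuous W) (hK : ∀ x, |W x| ≤ K) (hf : Continuous f) (hF : ∀ z, |f z| ≤ F)
    (q : ℝ × ℝ) (t : ℝ≥0) :
    ∫ ω in jumpEvent W X σ q t, (f (pathYS W (X ω) (σ ω) (U ω) q t) - f (pathHat W (X ω) q t)) ∂P
      = (∫ ω, f (pathYS W (X ω) (σ ω) (U ω) q t) ∂P) - ∫ ω, f (pathHat W (X ω) q t) ∂P := by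
  rw [← integral_sub (D.integrable_comp_pathYS hW hK hf hF q t)
    (D.integrable_comp_pathHat hW hf hF q t)]
  refine setIntegral_eq_integral_of_forall_compl_eq_zero fun ω no_jump => ?_
  rw [pathYS_eq_pathHat (not_le.1 no_jump), sub_self]

theorem abs_setIntegral_sub_firstJump_le [IsFiniteMeasure P] (D : RegularDrivers P X σ U)
    (hW : Continuous W) (hK : ∀ x, |W x| ≤ K) (L : LocalControl W K q t δ ε Λ)
    (hf : Continuous f) (hF : ∀ z, |f z| ≤ F) (hw₀ : 0 ≤ w)
    (hw : ∀ a b : ℝ × ℝ, |a.1 - b.1| ≤ δ → |a.2 - b.2| ≤ K * t → |f a - f b| ≤ w) :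
    |∫ ω in jumpEvent W X σ q t,
        (f (pathYS W (X ω) (σ ω) (U ω) q t) - f (pathHat W (X ω) q t) -
          (f (q.1 + firstJump W (X ω) (σ ω) q (U ω 0), q.2) - f q)) ∂P| ≤
      2 * w * P.real (jumpEvent W X σ q t) +
        4 * F * P.real ({ω | (σ ω 2 : ℝ) ≤ Λ * t} ∪ badEvent X σ δ t Λ) := by
  refine abs_setIntegral_le_of_le_of_le_off
    ((D.measurableSet_σ_le 2 _).union (D.measurableSet_badEvent δ t Λ))
    (((D.integrable_comp_pathYS hW hK hf hF q t).sub (D.integrable_comp_pathHat hW hf hF q t)).sub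
      (D.integrable_firstJump hW hK hf hF q)).integrableOn (mul_nonneg zero_le_two hw₀)
    (mul_nonneg zero_le_four ((abs_nonneg _).trans (hF q))) (fun ω jumps good => ?_) fun ω _ => ?_
  · have one_jump : (t : ℝ≥0∞) < (stage W (X ω) (σ ω) (U ω) q.1 q.2 2).time := not_le.1 fun h =>
      good (.inl (L.le_of_stage_time_le hW hK (D.cadlag ω) (D.σ_zero ω) h))
    have small : X ω ∈ smallPaths δ t := by_contra fun small =>
      good (.inr ⟨small, L.le_of_firstTime_le hW hK (D.cadlag ω) (D.σ_zero ω) jumps⟩)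
    exact abs_pathYS_sub_pathHat_sub_firstJump_le hW hK (D.cadlag ω)
      ((D.cadlag ω).mem_smallPaths_iff.1 small t le_rfl) hw jumps one_jump
  · refine (abs_sub _ _).trans ((add_le_add (abs_sub_le_two_mul_of_abs_le hF _ _)
      (abs_sub_le_two_mul_of_abs_le hF _ _)).trans_eq ?_)
    ring

theorem abs_integral_sub_sub_jumpOp_le [IsFiniteMeasure P] (D : RegularDrivers P X σ U)
    (hW : Continuous W) (hK : ∀ x, |W x| ≤ K) (L : LocalControl W K q t δ ε Λ) (hε : 0 ≤ ε)
    (hf : Continuous f) (hF : ∀ z, |f z| ≤ F) (hw₀ : 0 ≤ w)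
    (hw : ∀ a b : ℝ × ℝ, |a.1 - b.1| ≤ δ → |a.2 - b.2| ≤ K * t → |f a - f b| ≤ w) :
    |(∫ ω, f (pathYS W (X ω) (σ ω) (U ω) q t) ∂P) - (∫ ω, f (pathHat W (X ω) q t) ∂P) -
        t * jumpOp W f q| ≤
      t * (6 * F * Λ ^ 2 * t + 14 * F * Λ * P.real {ω | X ω ∉ smallPaths δ t} +
        (2 * Λ * w + 10 * F * ε)) := by
  have hF₀ : 0 ≤ F := (abs_nonneg _).trans (hF 0)
  have hΛ : 0 ≤ Λ := L.rate_nonneg hK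
  have hΛt : 0 ≤ Λ * t := mul_nonneg hΛ t.coe_nonneg
  have one_jump := D.abs_setIntegral_sub_firstJump_le hW hK L hf hF hw₀ hw
  have first_jump := D.abs_setIntegral_firstJump_sub_le hW hK L hε
    (h := fun x => f (q.1 + x, q.2) - f q) (by fun_prop)
    fun _ => abs_sub_le_two_mul_of_abs_le hF _ _
  have integrable_sub : Integrable (fun ω =>
      f (pathYS W (X ω) (σ ω) (U ω) q t) - f (pathHat W (X ω) q t)) P :=
    (D.integrable_comp_pathYS hW hK hf hF q t).sub (D.integrable_comp_pathHat hW hf hF q t)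
  rw [integral_sub integrable_sub.integrableOn
    (D.integrable_firstJump hW hK hf hF q).integrableOn,
    D.setIntegral_jumpEvent_sub hW hK hf hF q t] at one_jump
  rw [← jumpOp_eq_integral_mul_g] at first_jump
  have jump_prob : P.real (jumpEvent W X σ q t) ≤ Λ * t :=
    (measureReal_mono fun ω => L.le_of_firstTime_le hW hK (D.cadlag ω) (D.σ_zero ω)).trans
      (D.first_le _ hΛt)
  have bad_prob := D.measureReal_badEvent_le δ t hΛ
  have exception_prob := (measureReal_union_le (μ := P) {ω | (σ ω 2 : ℝ) ≤ Λ * t}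
    (badEvent X σ δ t Λ)).trans (add_le_add (D.second_le _ hΛt) bad_prob)
  refine (abs_sub_le _ _ _).trans ((add_le_add one_jump first_jump).trans ?_)
  linear_combination (2 * w) * jump_prob + (4 * F) * exception_prob + (10 * F) * bad_prob

end RegularDrivers

theorem eventually_mul_le (A : ℝ) {e : ℝ} (he : 0 < e) : ∀ᶠ t : ℝ≥0 in 𝓝[>] 0, A * t ≤ e := by
  have limit : Tendsto (fun t : ℝ≥0 => A * (t : ℝ)) (𝓝 0) (𝓝 0) :=
    (continuous_const.mul NNReal.continuous_coe).tendsto' _ _ (by simp)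
  exact (limit.mono_left nhdsWithin_le_nhds).eventually_le_const he

theorem eventually_forall_localControl (hW : UniformContinuous W) (hK : ∀ x, |W x| ≤ K) (m : ℝ)
    (hε : 0 < ε) : ∀ᶠ δ in 𝓝[>] 0, ∀ᶠ t : ℝ≥0 in 𝓝[>] 0, ∀ q : ℝ × ℝ, |q.2| ≤ m →
      LocalControl W K q t δ ε (4 * Real.pi * K * (m + K)) := by
  have hK₀ : 0 ≤ K := (abs_nonneg (W 0)).trans (hK 0)
  obtain ⟨c, hc, hcε⟩ := exists_pos_mul_lt hε (2 * Real.pi * (2 * K + 2 * |m|))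
  obtain ⟨δ₀, hδ₀, modulus⟩ := Metric.uniformContinuous_iff.1 hW c hc
  filter_upwards [Ioo_mem_nhdsGT hδ₀] with δ hδ
  filter_upwards [eventually_mul_le K hc, eventually_mul_le 1 one_pos] with t hKt ht q hq
  refine ⟨fun y s hy hs => ?_, fun y s hs => (gNorm_le hW.continuous hK y s).trans ?_⟩
  · have near (x : ℝ) : |W (y + x) - W (q.1 + x)| ≤ c := by
      refine (modulus ?_).le
      rw [Real.dist_eq, add_sub_add_right_eq_sub]
      exact hy.trans_lt hδ.2
    have hq' : |q.2| ≤ |m| := hq.trans (le_abs_self m)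
    have hs' : |s - q.2| ≤ c := hs.trans hKt
    calc ∫ x, |g W y s x - g W q.1 q.2 x|
        ≤ 2 * Real.pi * (2 * K * |s - q.2| + 2 * c * |q.2|) :=
          integral_abs_g_sub_le (abs_difference_mul_sub_le hK near _ _)
      _ ≤ 2 * Real.pi * (2 * K * c + 2 * c * |m|) := by
          gcongr
      _ = 2 * Real.pi * (2 * K + 2 * |m|) * c := by ring
      _ ≤ ε := hcε.le
  · have memory_le : |s| ≤ m + K := by
      have drift : K * t ≤ K := mul_le_of_le_one_right hK₀ (by rwa [one_mul] at ht)
      linarith [abs_sub_abs_le_abs_sub s q.2]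
    gcongr

theorem eventually_forall_abs_sub_le (hf : UniformContinuous f) (K : ℝ) (hw : 0 < w) :
    ∀ᶠ δ in 𝓝[>] 0, ∀ᶠ t : ℝ≥0 in 𝓝[>] 0, ∀ a b : ℝ × ℝ, |a.1 - b.1| ≤ δ →
      |a.2 - b.2| ≤ K * t → |f a - f b| ≤ w := by
  obtain ⟨δ₀, hδ₀, modulus⟩ := Metric.uniformContinuous_iff.1 hf w hw
  filter_upwards [Ioo_mem_nhdsGT hδ₀] with δ hδ
  filter_upwards [eventually_mul_le K hδ.1] with t hKt a b hfst hsnd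
  refine (modulus ?_).le
  rw [Prod.dist_eq, Real.dist_eq, Real.dist_eq]
  exact max_lt (hfst.trans_lt hδ.2) ((hsnd.trans hKt).trans_lt hδ.2)

namespace RegularDrivers

variable {Ω : Type*} {mΩ : MeasurableSpace Ω} {P : Measure Ω} {X : Ω → ℝ≥0 → ℝ}
  {σ : Ω → ℕ → ℝ≥0} {U : Ω → ℕ → ℝ}

theorem eventually_forall_abs_integral_sub_sub_jumpOp_le [IsFiniteMeasure P]
    (D : RegularDrivers P X σ U) (hW : UniformContinuous W) (hK : ∀ x, |W x| ≤ K)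
    (hf : UniformContinuous f) (hF : ∀ z, |f z| ≤ F) (m : ℝ) {e : ℝ} (he : 0 < e) :
    ∀ᶠ t : ℝ≥0 in 𝓝[>] 0, ∀ q : ℝ × ℝ, |q.2| ≤ m →
      |(∫ ω, f (pathYS W (X ω) (σ ω) (U ω) q t) ∂P) - (∫ ω, f (pathHat W (X ω) q t) ∂P) -
        t * jumpOp W f q| ≤ t * e := by
  set Λ := 4 * Real.pi * K * (m + K)
  obtain ⟨c, hc, hce⟩ := exists_pos_mul_lt (half_pos he) (2 * Λ + 10 * F)
  obtain ⟨δ, ⟨control, modulus⟩, hδ⟩ :=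
    (((eventually_forall_localControl hW hK m hc).and
      (eventually_forall_abs_sub_le hf K hc)).and self_mem_nhdsWithin).exists
  have error_tendsto : Tendsto (fun t : ℝ≥0 => 6 * F * Λ ^ 2 * t +
      14 * F * Λ * P.real {ω | X ω ∉ smallPaths δ t}) (𝓝[>] 0) (𝓝 0) := by
    have time : Tendsto (fun t : ℝ≥0 => (t : ℝ)) (𝓝[>] 0) (𝓝 0) :=
      (NNReal.continuous_coe.tendsto' 0 0 NNReal.coe_zero).mono_left nhdsWithin_le_nhds
    simpa only [mul_zero, add_zero] using (time.const_mul (6 * F * Λ ^ 2)).add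
      ((tendsto_measureReal_notMem_smallPaths D.measurable_X D.cadlag D.start hδ).const_mul
        (14 * F * Λ))
  filter_upwards [control, modulus, error_tendsto.eventually_lt_const (half_pos he)]
    with t control modulus error q hq
  refine (D.abs_integral_sub_sub_jumpOp_le hW.continuous hK (control q hq) hc.le hf.continuous hF
    hc.le modulus).trans (mul_le_mul_of_nonneg_left ?_ t.coe_nonneg)
  linarith

theorem integral_sub_sub_jumpOp_eq_zero (D : RegularDrivers P X σ U)
    (hW : Continuous W) (hK : ∀ x, |W x| ≤ K) {M : ℝ} (hM : ∀ z, M < |z.2| → f z = 0)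
    (hq : M + K < |q.2|) (ht : t ≤ 1) :
    (∫ ω, f (pathYS W (X ω) (σ ω) (U ω) q t) ∂P) - (∫ ω, f (pathHat W (X ω) q t) ∂P) -
      t * jumpOp W f q = 0 := by
  have hK₀ : 0 ≤ K := (abs_nonneg (W 0)).trans (hK 0)
  have drift : K * t ≤ K := mul_le_of_le_one_right hK₀ ht
  have vanishes {z : ℝ × ℝ} (hz : |z.2 - q.2| ≤ K * t) : f z = 0 := hM z (by
    linarith [abs_sub_abs_le_abs_sub q.2 z.2, abs_sub_comm q.2 z.2])
  have jumping (ω : Ω) : f (pathYS W (X ω) (σ ω) (U ω) q t) = 0 :=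
    vanishes (abs_pathYS_snd_sub_le hW hK (D.cadlag ω))
  have jump_free (ω : Ω) : f (pathHat W (X ω) q t) = 0 := vanishes (abs_pathHat_snd_sub_le hK)
  have jumpOp_zero : jumpOp W f q = 0 := jumpOp_eq_zero fun x => hM _ (by
    simpa only using (le_add_of_nonneg_right hK₀).trans_lt hq)
  simp only [jumping, jump_free, jumpOp_zero, integral_zero, mul_zero, sub_zero]

theorem tendstoUniformly_integral_sub [IsFiniteMeasure P] (D : RegularDrivers P X σ U)
    (hW : UniformContinuous W) (hK : ∀ x, |W x| ≤ K) (hf : IsCStar f) :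
    TendstoUniformly (fun (t : ℝ≥0) q => ((∫ ω, f (pathYS W (X ω) (σ ω) (U ω) q t) ∂P) -
      ∫ ω, f (pathHat W (X ω) q t) ∂P) / (t : ℝ)) (jumpOp W f) (𝓝[>] 0) := by
  obtain ⟨F, hF⟩ := hf.bounded
  obtain ⟨M, -, support⟩ := hf.support
  have vanishes (z : ℝ × ℝ) (hz : M < |z.2|) : f z = 0 :=
    by_contra fun h => (support h).not_gt hz
  refine Metric.tendstoUniformly_iff.2 fun e he => ?_
  filter_upwards [self_mem_nhdsWithin, eventually_mul_le 1 one_pos,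
    D.eventually_forall_abs_integral_sub_sub_jumpOp_le hW hK hf.uniformContinuous hF (M + K)
      (half_pos he)] with t ht ht_one strip q
  have ht₀ : (0 : ℝ) < t := NNReal.coe_pos.2 ht
  set T := ∫ ω, f (pathYS W (X ω) (σ ω) (U ω) q t) ∂P
  set T' := ∫ ω, f (pathHat W (X ω) q t) ∂P
  have close : |T - T' - t * jumpOp W f q| ≤ t * (e / 2) := by
    rcases le_or_gt |q.2| (M + K) with hq | hq
    · exact strip q hq
    · rw [D.integral_sub_sub_jumpOp_eq_zero hW.continuous hK vanishes hq
        (by rwa [one_mul] at ht_one), abs_zero]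
      positivity
  rw [dist_comm, Real.dist_eq, show (T - T') / t - jumpOp W f q =
    (T - T' - t * jumpOp W f q) / t by field_simp, abs_div, abs_of_pos ht₀, div_lt_iff₀ ht₀]
  linarith [mul_pos ht₀ he]

end RegularDrivers

end Comparison

/-! ### Jump times of the Poisson process -/

section Poisson

/-- The first time a path reaches the level `k`, computed from countably many times. It agrees with
`jumpTime` on monotone paths and is a measurable function of the path. -/
def denseJumpTime (n : ℝ≥0 → ℕ) (k : ℕ) : ℝ≥0 :=
  (⨅ i, if k ≤ n (TopologicalSpace.denseSeq ℝ≥0 i) then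
    (TopologicalSpace.denseSeq ℝ≥0 i : ℝ≥0∞) else ∞).toNNReal

theorem measurable_denseJumpTime : Measurable denseJumpTime :=
  measurable_pi_iff.2 fun _ => (Measurable.iInf fun _ => .ite
    (measurableSet_le measurable_const (measurable_pi_apply _))
    measurable_const measurable_const).ennreal_toNNReal

theorem denseJumpTime_eq_jumpTime {n : ℝ≥0 → ℕ} {k : ℕ} (h : IsUpperSet {t | k ≤ n t}) :
    denseJumpTime n k = jumpTime n k := by
  rcases eq_empty_or_nonempty {t | k ≤ n t} with empty | nonempty
  · have never (t : ℝ≥0) : ¬ k ≤ n t := eq_empty_iff_forall_notMem.1 empty t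
    simp [denseJumpTime, jumpTime, never]
  rw [← ENNReal.toNNReal_coe (jumpTime n k), denseJumpTime]
  refine congrArg ENNReal.toNNReal (le_antisymm (le_of_forall_gt fun c hc => ?_)
    (le_iInf fun i => ?_))
  · obtain ⟨c', hc', hcc'⟩ := ENNReal.lt_iff_exists_nnreal_btwn.1 hc
    obtain ⟨t, ht, htc⟩ := exists_lt_of_csInf_lt nonempty (ENNReal.coe_lt_coe.1 hc')
    obtain ⟨i, lt_i, i_lt⟩ := (TopologicalSpace.denseRange_denseSeq ℝ≥0).exists_mem_open
      isOpen_Ioo (nonempty_Ioo.2 htc)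
    refine (iInf_le _ i).trans_lt ?_
    rw [if_pos (show k ≤ n _ from h lt_i.le ht)]
    exact (ENNReal.coe_lt_coe.2 i_lt).trans hcc'
  · split_ifs with hi
    · exact ENNReal.coe_le_coe.2 (csInf_le (OrderBot.bddBelow _) hi)
    · exact le_top

theorem denseJumpTime_zero (n : ℝ≥0 → ℕ) : denseJumpTime n 0 = 0 := by
  rw [denseJumpTime_eq_jumpTime fun _ t _ _ => Nat.zero_le (n t)]
  exact le_antisymm (csInf_le (OrderBot.bddBelow _) (Nat.zero_le (n 0))) zero_le

theorem jumpTime_le_iff {n : ℝ≥0 → ℕ} (hn : Monotone n) (hc : IsCadlag n) {k : ℕ}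
    (h : ∃ t, k ≤ n t) (a : ℝ≥0) : jumpTime n k ≤ a ↔ k ≤ n a := by
  refine ⟨fun le => ?_, fun le => csInf_le (OrderBot.bddBelow _) le⟩
  have constant_right : ∀ᶠ b in 𝓝[>] a, n b = n a := by
    have right := (hc a).1.tendsto.mono_left (nhdsWithin_mono _ Ioi_subset_Ici_self)
    rwa [nhds_discrete, tendsto_pure] at right
  obtain ⟨b, hb, hab⟩ := (constant_right.and self_mem_nhdsWithin).exists
  obtain ⟨t, ht, htb⟩ := exists_lt_of_csInf_lt h (le.trans_lt hab)
  exact hb ▸ le_trans ht (hn htb.le)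

theorem poissonMeasure_real_Ici (r : ℝ≥0) (k : ℕ) : (poissonMeasure r).real (Ici k) =
    1 - ∑ i ∈ Finset.range k, Real.exp (-r) * r ^ i / i.factorial := by
  rw [← compl_Iio, ← Finset.coe_Iio, probReal_compl_eq_one_sub (Finset.measurableSet _),
    ← sum_measureReal_singleton]
  simp only [poissonMeasure_real_singleton, Nat.Iio_eq_range]

namespace IsPoissonProcess

variable {Ω : Type*} [MeasurableSpace Ω] {P : Measure Ω} {N : ℝ≥0 → Ω → ℕ}

theorem map_eq (hN : IsPoissonProcess N P) (t : ℝ≥0) : P.map (N t) = poissonMeasure t := by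
  rw [← tsub_zero t, ← hN.law_increment 0 t zero_le, tsub_zero]
  refine Measure.map_congr ?_
  filter_upwards [hN.start] with ω hω
  rw [hω, tsub_zero]

theorem measureReal_le_eq (hN : IsPoissonProcess N P) (k : ℕ) (t : ℝ≥0) :
    P.real {ω | k ≤ N t ω} =
      1 - ∑ i ∈ Finset.range k, Real.exp (-t) * t ^ i / i.factorial := by
  rw [← poissonMeasure_real_Ici, ← hN.map_eq,
    map_measureReal_apply (hN.measurable t) measurableSet_Ici]
  rfl

theorem ae_exists_le [IsProbabilityMeasure P] (hN : IsPoissonProcess N P) (k : ℕ) :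
    ∀ᵐ ω ∂P, ∃ t, k ≤ N t ω := by
  have limit : Tendsto (fun n : ℕ => P.real {ω | k ≤ N n ω}) atTop (𝓝 1) := by
    have term (i : ℕ) : Tendsto (fun n : ℕ => Real.exp (-n) * (n : ℝ) ^ i / i.factorial) atTop
        (𝓝 0) := by
      simpa only [zero_div, mul_comm, Function.comp_def] using
        ((Real.tendsto_pow_mul_exp_neg_atTop_nhds_zero i).comp
          tendsto_natCast_atTop_atTop).div_const (i.factorial : ℝ)
    have sum := (tendsto_finsetSum (Finset.range k) fun i _ => term i).const_sub 1
    simpa only [hN.measureReal_le_eq, NNReal.coe_natCast, Finset.sum_const_zero, sub_zero] using sum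
  have measurable_exists : MeasurableSet {ω | ∃ n : ℕ, k ≤ N n ω} := by
    simp only [ofPred_exists]
    exact .iUnion fun n => measurableSet_le measurable_const (hN.measurable _)
  have one_le : 1 ≤ P.real {ω | ∃ n : ℕ, k ≤ N n ω} :=
    le_of_tendsto limit (.of_forall fun n => measureReal_mono fun ω hω => ⟨n, hω⟩)
  have ae_nat : ∀ᵐ ω ∂P, ∃ n : ℕ, k ≤ N n ω := by
    refine (mem_ae_iff_prob_eq_one measurable_exists).2 (le_antisymm prob_le_one ?_)
    rw [← ENNReal.ofReal_one]
    exact ENNReal.ofReal_le_of_le_toReal one_le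
  filter_upwards [ae_nat] with ω ⟨n, hn⟩ using ⟨n, hn⟩

theorem ae_denseJumpTime_eq (hN : IsPoissonProcess N P) :
    ∀ᵐ ω ∂P, denseJumpTime (fun t => N t ω) = jumpTime fun t => N t ω := by
  filter_upwards [hN.monotone] with ω hω
  exact funext fun k => denseJumpTime_eq_jumpTime fun _ _ hst hk => le_trans hk (hω hst)

theorem measureReal_denseJumpTime_le_eq [IsProbabilityMeasure P] (hN : IsPoissonProcess N P)
    (k : ℕ) {a : ℝ} (ha : 0 ≤ a) : P.real {ω | (denseJumpTime (fun t => N t ω) k : ℝ) ≤ a} =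
      1 - ∑ i ∈ Finset.range k, Real.exp (-a) * a ^ i / i.factorial := by
  lift a to ℝ≥0 using ha
  rw [← hN.measureReal_le_eq]
  refine measureReal_congr ?_
  filter_upwards [hN.monotone, hN.cadlag, hN.ae_exists_le k, hN.ae_denseJumpTime_eq]
    with ω monotone cadlag reached eq
  refine propext (Iff.trans ?_ (jumpTime_le_iff monotone cadlag reached a))
  rw [← eq]
  exact NNReal.coe_le_coe

end IsPoissonProcess

theorem exp_neg_le_one_sub_add_sq {a : ℝ} (ha : 0 ≤ a) : Real.exp (-a) ≤ 1 - a + a ^ 2 := by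
  have pos : 0 < 1 - a + a ^ 2 := by nlinarith
  rw [Real.exp_neg, inv_le_comm₀ (Real.exp_pos a) pos]
  refine le_trans ?_ (Real.add_one_le_exp a)
  rw [inv_le_iff_one_le_mul₀ pos]
  linarith [pow_nonneg ha 3, show (a + 1) * (1 - a + a ^ 2) = 1 + a ^ 3 by ring]

theorem exists_cadlag_modification {Ω : Type*} [MeasurableSpace Ω] {P : Measure Ω}
    {X : ℝ≥0 → Ω → ℝ} (hX : ∀ t, Measurable (X t)) (h0 : ∀ᵐ ω ∂P, X 0 ω = 0)
    (hc : ∀ᵐ ω ∂P, IsCadlag fun t => X t ω) :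
    ∃ X' : Ω → ℝ≥0 → ℝ, Measurable X' ∧ (∀ ω, IsCadlag (X' ω)) ∧ (∀ ω, X' ω 0 = 0) ∧
      (fun ω t => X t ω) =ᵐ[P] X' := by
  obtain ⟨G, hG, hGm, hGp⟩ := (h0.and hc).exists_measurable_mem
  refine ⟨fun ω t => G.indicator (X t) ω, measurable_pi_iff.2 fun t => (hX t).indicator hGm,
    fun ω => ?_, fun ω => ?_, ?_⟩
  · by_cases hω : ω ∈ G
    · simpa only [indicator_of_mem hω] using (hGp ω hω).2
    · simp only [indicator_of_notMem hω]
      exact fun t => ⟨continuousWithinAt_const, 0, tendsto_const_nhds⟩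
  · by_cases hω : ω ∈ G
    · simpa only [indicator_of_mem hω] using (hGp ω hω).1
    · exact indicator_of_notMem hω _
  · filter_upwards [hG] with ω hω
    simp only [indicator_of_mem hω]

theorem exists_regularDrivers {Ω : Type*} [MeasurableSpace Ω] {P : Measure Ω}
    [IsProbabilityMeasure P] {X : ℝ≥0 → Ω → ℝ} {N : ℝ≥0 → Ω → ℕ} {U : ℕ → Ω → ℝ}
    (hX : ∀ t, Measurable (X t)) (hX0 : ∀ᵐ ω ∂P, X 0 ω = 0)
    (hXc : ∀ᵐ ω ∂P, IsCadlag fun t => X t ω) (hN : IsPoissonProcess N P)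
    (hU : IsUniformSequence U P) (hindep : IndependentDrivers X N U P) :
    ∃ (X' : Ω → ℝ≥0 → ℝ) (σ : Ω → ℕ → ℝ≥0), RegularDrivers P X' σ (fun ω n => U n ω) ∧
      ∀ᵐ ω ∂P, (fun t => X t ω) = X' ω ∧ jumpTime (fun t => N t ω) = σ ω := by
  obtain ⟨X', measurable_X', cadlag, start, X_eq⟩ := exists_cadlag_modification hX hX0 hXc
  let σ : Ω → ℕ → ℝ≥0 := fun ω => denseJumpTime fun t => N t ω
  have pairs : (fun ω => (X' ω, σ ω)) =ᵐ[P] fun ω => (fun t => X t ω, σ ω) := by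
    filter_upwards [X_eq] with ω hω
    rw [hω]
  refine ⟨X', σ, ?_, X_eq.and (hN.ae_denseJumpTime_eq.mono fun _ h => h.symm)⟩
  exact
    { measurable_X := measurable_X'
      cadlag := cadlag
      start := start
      measurable_σ := measurable_denseJumpTime.comp (measurable_pi_iff.2 hN.measurable)
      σ_zero := fun ω => denseJumpTime_zero _
      measurable_U := measurable_pi_iff.2 hU.measurable
      law_U := hU.law 0
      indep_X_σ := (hindep.1.comp measurable_id measurable_denseJumpTime).congr X_eq .rfl
      indep_U := (hindep.2.comp (measurable_fst.prodMk (measurable_denseJumpTime.comp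
        measurable_snd)) (measurable_pi_apply 0)).congr pairs.symm .rfl
      first_le := fun a ha => by
        rw [hN.measureReal_denseJumpTime_le_eq 1 ha, Finset.sum_range_one]
        simp only [pow_zero, Nat.factorial_zero, Nat.cast_one, mul_one, div_one]
        linarith [Real.add_one_le_exp (-a)]
      le_first := fun a ha => by
        rw [hN.measureReal_denseJumpTime_le_eq 1 ha, Finset.sum_range_one]
        simp only [pow_zero, Nat.factorial_zero, Nat.cast_one, mul_one, div_one]
        linarith [exp_neg_le_one_sub_add_sq ha]
      second_le := fun a ha => by
        rw [hN.measureReal_denseJumpTime_le_eq 2 ha, Finset.sum_range_succ, Finset.sum_range_one]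
        simp only [pow_zero, pow_one, Nat.factorial, Nat.cast_one, mul_one, div_one]
        nlinarith [Real.add_one_le_exp (-a)] }

end Poisson

/-! ### The circle -/

section Circle

open scoped Real

variable {V : Circle → ℝ} {f : Circle × ℝ → ℝ}

theorem uniformContinuous_circleExp : UniformContinuous Circle.exp := by
  refine LipschitzWith.uniformContinuous (K := 1) (LipschitzWith.of_dist_le_mul fun x y => ?_)
  have h := (lipschitzWith_circleMap 0 1).dist_le_mul x y
  simp only [circleMap, zero_add, Complex.ofReal_one, one_mul, map_one, ← Circle.coe_exp] at h
  exact h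

theorem continuous_of_continuous_lift (hV : Continuous (lift V)) : Continuous V :=
  (isLocalHomeomorph_circleExp.isOpenMap.isQuotientMap Circle.exp.continuous
    Circle.exp_surjective).continuous_iff.2 hV

theorem uniformContinuous_lift (hV : Continuous V) : UniformContinuous (lift V) :=
  (CompactSpace.uniformContinuous_of_continuous hV).comp uniformContinuous_circleExp

theorem exists_abs_lift_le (hV : Continuous V) : ∃ K, ∀ x, |lift V x| ≤ K := by
  obtain ⟨K, hK⟩ := isCompact_univ.exists_bound_of_continuousOn hV.continuousOn
  exact ⟨K, fun x => hK _ (mem_univ _)⟩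

theorem wrap_unwrap (p : Circle × ℝ) : wrap (unwrap p) = p :=
  Prod.ext (Circle.exp_arg p.1) rfl

theorem uniformContinuous_wrap : UniformContinuous wrap :=
  (uniformContinuous_circleExp.comp uniformContinuous_fst).prodMk uniformContinuous_snd

theorem exists_strip_of_hasCompactSupport (hc : HasCompactSupport f) :
    ∃ M : ℝ, 0 < M ∧ ∀ p, M < |p.2| → f p = 0 := by
  obtain ⟨M, hM, subset⟩ :=
    (hc.isCompact.image continuous_snd).isBounded.subset_closedBall_lt 0 0
  refine ⟨M, hM, fun p hp => by_contra fun h => hp.not_ge ?_⟩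
  simpa using subset ⟨p, subset_tsupport f h, rfl⟩

theorem isCStar_comp_wrap (hf : Continuous f) (hc : HasCompactSupport f) :
    IsCStar fun q => f (wrap q) := by
  obtain ⟨M, hM, vanish⟩ := exists_strip_of_hasCompactSupport hc
  obtain ⟨B, hB⟩ := hc.exists_bound_of_continuous hf
  exact ⟨⟨B, fun q => hB (wrap q)⟩,
    (hc.uniformContinuous_of_continuous hf).comp uniformContinuous_wrap,
    M, hM, fun q hq => not_lt.1 fun h => hq (vanish (wrap q) h)⟩

theorem jumpOpCircle_eq_jumpOp (V : Circle → ℝ) (f : Circle × ℝ → ℝ) (p : Circle × ℝ) :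
    jumpOpCircle V f p = jumpOp (lift V) (fun q => f (wrap q)) (unwrap p) := by
  have periodic : Function.Periodic (fun x : ℝ => (f (Circle.exp x, p.2) - f p) *
      max ((V p.1 - V (Circle.exp x)) * p.2) 0) (2 * π) := fun x => by
    simp only [Circle.exp_add_two_pi]
  have shift := periodic.intervalIntegral_add_eq (-π) (-π + (unwrap p).1)
  rw [show -π + 2 * π = π by ring,
    show -π + (unwrap p).1 + 2 * π = π + (unwrap p).1 by ring] at shift
  have exp_unwrap : Circle.exp (unwrap p).1 = p.1 := Circle.exp_arg p.1
  simp only [jumpOpCircle, arcIntegral, jumpOp, wrap_unwrap, lift, exp_unwrap]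
  exact shift

theorem continuous_jumpOpCircle (hV : Continuous V) (hf : Continuous f) :
    Continuous (jumpOpCircle V f) := by
  refine intervalIntegral.continuous_parametric_intervalIntegral_of_continuous'
    (f := fun (p : Circle × ℝ) θ => (f (Circle.exp θ, p.2) - f p) *
      max ((V p.1 - V (Circle.exp θ)) * p.2) 0) ?_ _ _
  simp only [Function.uncurry_def]
  fun_prop

theorem hasCompactSupport_jumpOpCircle (hc : HasCompactSupport f) :
    HasCompactSupport (jumpOpCircle V f) := by
  obtain ⟨M, -, vanish⟩ := exists_strip_of_hasCompactSupport hc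
  refine HasCompactSupport.intro (isCompact_univ.prod (isCompact_Icc (a := -M) (b := M)))
    fun p hp => ?_
  have hM : M < |p.2| := not_le.1 fun h => hp ⟨mem_univ _, abs_le.1 h⟩
  have fibre (w : Circle) : f (w, p.2) = 0 := vanish _ hM
  simp [jumpOpCircle, arcIntegral, fibre]

/-- `R^𝕊 f` as an element of `C₀(𝕊 × ℝ)`, for compactly supported `f`. -/
def jumpOpCircleC0 (hV : Continuous V) (f : C₀(Circle × ℝ, ℝ)) (hc : HasCompactSupport f) :
    C₀(Circle × ℝ, ℝ) where
  toFun := jumpOpCircle V f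
  continuous_toFun := continuous_jumpOpCircle hV f.continuous
  zero_at_infty' := (hasCompactSupport_jumpOpCircle hc).is_zero_at_infty

end Circle

/-! ### Generators -/

section Generator

open scoped Real

/-- `lim_{t → 0+} (T_t f - T'_t f)/t = R` in the supremum norm: the difference of the generators of
`T` and `T'` at `f` is `R`, without requiring `f` to lie in either domain. -/
def IsGenDifference {E : Type*} (T T' : ℝ≥0 → (E → ℝ) → E → ℝ) (f R : E → ℝ) : Prop :=
  TendstoUniformly (fun (t : ℝ≥0) q => (T t f q - T' t f q) / (t : ℝ)) R (𝓝[>] 0)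

namespace IsGenDifference

section Limit

variable {E : Type*} {T T' : ℝ≥0 → (E → ℝ) → E → ℝ} {f L L' R : E → ℝ}

theorem isGenLimit_add (h : IsGenDifference T T' f R) (hL : IsGenLimit T' f L) :
    IsGenLimit T f (L + R) := by
  unfold IsGenLimit
  convert! TendstoUniformly.add hL h using 3
  simp only [Pi.add_apply]
  ring

theorem isGenLimit_sub (h : IsGenDifference T T' f R) (hL : IsGenLimit T f L) :
    IsGenLimit T' f (L - R) := by
  unfold IsGenLimit
  convert! TendstoUniformly.sub hL h using 3
  simp only [Pi.sub_apply]
  ring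

theorem exists_isGenLimit_iff (h : IsGenDifference T T' f R) :
    (∃ L, IsGenLimit T f L) ↔ ∃ L, IsGenLimit T' f L :=
  ⟨fun ⟨_, hL⟩ => ⟨_, h.isGenLimit_sub hL⟩, fun ⟨_, hL⟩ => ⟨_, h.isGenLimit_add hL⟩⟩

theorem eq_add (h : IsGenDifference T T' f R) (hL : IsGenLimit T f L) (hL' : IsGenLimit T' f L') :
    L = L' + R :=
  hL.unique (h.isGenLimit_add hL')

end Limit

section Domain

variable {E : Type*} [TopologicalSpace E] {T T' : ℝ≥0 → (E → ℝ) → E → ℝ} {f : C₀(E, ℝ)}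

theorem mem_genDomain_iff {R : C₀(E, ℝ)} (h : IsGenDifference T T' f R) :
    f ∈ genDomain T ↔ f ∈ genDomain T' :=
  ⟨fun ⟨L, hL⟩ => ⟨L - R, h.isGenLimit_sub hL⟩, fun ⟨L, hL⟩ => ⟨L + R, h.isGenLimit_add hL⟩⟩

theorem generator_eq_add {R : E → ℝ} (h : IsGenDifference T T' f R) (hf : f ∈ genDomain T)
    (hf' : f ∈ genDomain T') (p : E) : generator T f hf p = generator T' f hf' p + R p :=
  congrFun (h.eq_add (generator_spec hf) (generator_spec hf')) p

end Domain

end IsGenDifference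

variable {Ω : Type*} [MeasurableSpace Ω] {P : Measure Ω} [IsProbabilityMeasure P]
  {X : ℝ≥0 → Ω → ℝ} {N : ℝ≥0 → Ω → ℕ} {U : ℕ → Ω → ℝ}

theorem isGenDifference_semigroupYS_semigroupHat {W : ℝ → ℝ} {K : ℝ} (hW : UniformContinuous W)
    (hK : ∀ x, |W x| ≤ K) (hX : ∀ t, Measurable (X t)) (hX0 : ∀ᵐ ω ∂P, X 0 ω = 0)
    (hXc : ∀ᵐ ω ∂P, IsCadlag fun t => X t ω) (hN : IsPoissonProcess N P)
    (hU : IsUniformSequence U P) (hindep : IndependentDrivers X N U P) {f : ℝ × ℝ → ℝ}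
    (hf : IsCStar f) :
    IsGenDifference (semigroupYS P W X N U) (semigroupHat P W X) f (jumpOp W f) := by
  obtain ⟨X', σ, D, drivers_eq⟩ := exists_regularDrivers hX hX0 hXc hN hU hindep
  have semigroupYS_eq (t : ℝ≥0) (q : ℝ × ℝ) : semigroupYS P W X N U t f q =
      ∫ ω, f (pathYS W (X' ω) (σ ω) (fun n => U n ω) q t) ∂P := by
    refine integral_congr_ae ?_
    filter_upwards [drivers_eq] with ω hω
    simp only [processYS, hω.1, hω.2]
  have semigroupHat_eq (t : ℝ≥0) (q : ℝ × ℝ) :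
      semigroupHat P W X t f q = ∫ ω, f (pathHat W (X' ω) q t) ∂P := by
    refine integral_congr_ae ?_
    filter_upwards [drivers_eq] with ω hω
    simp only [processHat, hω.1]
  simpa only [IsGenDifference, semigroupYS_eq, semigroupHat_eq] using
    D.tendstoUniformly_integral_sub hW hK hf

theorem isGenDifference_semigroupZS_semigroupZHat {V : Circle → ℝ} (hV : Continuous V)
    (hX : ∀ t, Measurable (X t)) (hX0 : ∀ᵐ ω ∂P, X 0 ω = 0)
    (hXc : ∀ᵐ ω ∂P, IsCadlag fun t => X t ω) (hN : IsPoissonProcess N P)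
    (hU : IsUniformSequence U P) (hindep : IndependentDrivers X N U P) {f : Circle × ℝ → ℝ}
    (hf : Continuous f) (hc : HasCompactSupport f) :
    IsGenDifference (semigroupZS P (lift V) X N U) (semigroupZHat P (lift V) X) f
      (jumpOpCircle V f) := by
  obtain ⟨K, hK⟩ := exists_abs_lift_le hV
  have plane := isGenDifference_semigroupYS_semigroupHat (uniformContinuous_lift hV) hK hX hX0 hXc
    hN hU hindep (isCStar_comp_wrap hf hc)
  rw [funext (jumpOpCircle_eq_jumpOp V f)]
  exact TendstoUniformly.comp plane unwrap

theorem abs_jumpOp_le {W : ℝ → ℝ} {K : ℝ} (hW : Continuous W) (hK : ∀ x, |W x| ≤ K) {M B : ℝ}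
    {f : ℝ × ℝ → ℝ} (hf : Function.support f ⊆ {q | |q.2| ≤ M}) (hB : ∀ q, |f q| ≤ B)
    (q : ℝ × ℝ) : |jumpOp W f q| ≤ 8 * π * K * |M| * B := by
  have K_nonneg : 0 ≤ K := (abs_nonneg (W 0)).trans (hK 0)
  have B_nonneg : 0 ≤ B := (abs_nonneg _).trans (hB 0)
  rcases lt_or_ge M |q.2| with outside | inside
  · have vanish (x : ℝ) : f (x, q.2) = 0 := by_contra fun h => outside.not_ge (@hf (x, q.2) h)
    rw [jumpOp_eq_zero vanish, abs_zero]
    positivity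
  · calc |jumpOp W f q| ≤ 2 * B * gNorm W q.1 q.2 := by
          rw [jumpOp_eq_integral_mul_g]
          exact abs_integral_mul_g_le hW (fun _ => abs_sub_le_two_mul_of_abs_le hB _ _) _ _
      _ ≤ 2 * B * (4 * π * K * |M|) := by
          grw [gNorm_le hW hK q.1 q.2, inside.trans (le_abs_self M)]
      _ = 8 * π * K * |M| * B := by ring

end Generator

end MemoryJump

end

open MemoryJump in
theorem proposition2_general {Ω : Type*} [MeasurableSpace Ω] (P : Measure Ω)
    [IsProbabilityMeasure P] (V : Circle → ℝ) (hV : Continuous V)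
    (X : ℝ≥0 → Ω → ℝ) (hX : ∀ t, Measurable (X t)) (hX0 : ∀ᵐ ω ∂P, X 0 ω = 0)
    (hXc : ∀ᵐ ω ∂P, IsCadlag fun t => X t ω)
    (N : ℝ≥0 → Ω → ℕ) (hN : IsPoissonProcess N P)
    (U : ℕ → Ω → ℝ) (hU : IsUniformSequence U P)
    (hindep : IndependentDrivers X N U P) :
    (∀ f : ℝ × ℝ → ℝ, IsCStar f →
      ((∃ L : ℝ × ℝ → ℝ, IsGenLimit (semigroupYS P (lift V) X N U) f L) ↔
        ∃ L : ℝ × ℝ → ℝ, IsGenLimit (semigroupHat P (lift V) X) f L) ∧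
      ∀ L L' : ℝ × ℝ → ℝ, IsGenLimit (semigroupYS P (lift V) X N U) f L →
        IsGenLimit (semigroupHat P (lift V) X) f L' → L = L' + jumpOp (lift V) f) ∧
    (∀ M : ℝ, ∃ C : ℝ, ∀ f : ℝ × ℝ → ℝ, IsCStar f →
      Function.support f ⊆ {q | |q.2| ≤ M} →
      ∀ B : ℝ, (∀ q, |f q| ≤ B) → ∀ q, |jumpOp (lift V) f q| ≤ C * B) ∧
    (genDomain (semigroupZS P (lift V) X N U) ∩ CcSet (Circle × ℝ) =
      genDomain (semigroupZHat P (lift V) X) ∩ CcSet (Circle × ℝ)) ∧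
    (∀ (f : C₀(Circle × ℝ, ℝ)) (hf : f ∈ genDomain (semigroupZS P (lift V) X N U))
      (hf' : f ∈ genDomain (semigroupZHat P (lift V) X)),
      f ∈ CcSet (Circle × ℝ) →
      ∀ p, generator _ f hf p = generator _ f hf' p + jumpOpCircle V f p) := by
  have hW := uniformContinuous_lift hV
  obtain ⟨K, hK⟩ := exists_abs_lift_le hV
  have plane (f : ℝ × ℝ → ℝ) (hf : IsCStar f) :=
    isGenDifference_semigroupYS_semigroupHat hW hK hX hX0 hXc hN hU hindep hf
  have cylinder (f : C₀(Circle × ℝ, ℝ)) (hc : HasCompactSupport f) :=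
    isGenDifference_semigroupZS_semigroupZHat hV hX hX0 hXc hN hU hindep f.continuous hc
  refine ⟨fun f hf => ⟨(plane f hf).exists_isGenLimit_iff, fun _ _ => (plane f hf).eq_add⟩,
    fun M => ⟨8 * Real.pi * K * |M|, fun _ _ hf _ hB => abs_jumpOp_le hW.continuous hK hf hB⟩,
    Set.ext fun f => and_congr_left fun hc => ?_,
    fun f hf hf' hc => (cylinder f hc).generator_eq_add hf hf'⟩
  exact IsGenDifference.mem_genDomain_iff (R := jumpOpCircleC0 hV f hc) (cylinder f hc)

open MemoryJump in
theorem proposition2 {Ω : Type*} [MeasurableSpace Ω] (P : Measure Ω) [IsProbabilityMeasure P]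
    (α : ℝ) (hα : α ∈ Ioo (0 : ℝ) 2)
    (V : Circle → ℝ) (hV : ContDiff ℝ 3 (lift V)) (hV_mean : arcIntegral V = 0)
    (hV_const : ¬ ∃ c : ℝ, ∀ z, V z = c)
    (X : ℝ≥0 → Ω → ℝ) (hX : IsSymmetricStableProcess α X P)
    (N : ℝ≥0 → Ω → ℕ) (hN : IsPoissonProcess N P)
    (U : ℕ → Ω → ℝ) (hU : IsUniformSequence U P)
    (hindep : IndependentDrivers X N U P) :
    -- the generator limits on `C_*(ℝ²)`
    (∀ f : ℝ × ℝ → ℝ, IsCStar f →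
      ((∃ L : ℝ × ℝ → ℝ, IsGenLimit (semigroupYS P (lift V) X N U) f L) ↔
        ∃ L : ℝ × ℝ → ℝ, IsGenLimit (semigroupHat P (lift V) X) f L) ∧
      ∀ L L' : ℝ × ℝ → ℝ, IsGenLimit (semigroupYS P (lift V) X N U) f L →
        IsGenLimit (semigroupHat P (lift V) X) f L' → L = L' + jumpOp (lift V) f) ∧
    -- the jump operator is bounded on functions supported in a fixed strip
    (∀ M : ℝ, ∃ C : ℝ, ∀ f : ℝ × ℝ → ℝ, IsCStar f →
      Function.support f ⊆ {q | |q.2| ≤ M} →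
      ∀ B : ℝ, (∀ q, |f q| ≤ B) → ∀ q, |jumpOp (lift V) f q| ≤ C * B) ∧
    -- the generators of the processes on `𝕊 × ℝ`
    (genDomain (semigroupZS P (lift V) X N U) ∩ CcSet (Circle × ℝ) =
      genDomain (semigroupZHat P (lift V) X) ∩ CcSet (Circle × ℝ)) ∧
    (∀ (f : C₀(Circle × ℝ, ℝ)) (hf : f ∈ genDomain (semigroupZS P (lift V) X N U))
      (hf' : f ∈ genDomain (semigroupZHat P (lift V) X)),
      f ∈ CcSet (Circle × ℝ) →
      ∀ p, generator _ f hf p = generator _ f hf' p + jumpOpCircle V f p) :=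
  proposition2_general P V (continuous_of_continuous_lift hV.continuous) X hX.measurable hX.start
    hX.cadlag N hN U hU hindep
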